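/- Consider the binary write-once memory with writing noise: the memoryless channel with input, state and output alphabets $\{0,1\}$, in which the states $S_1,S_2,\dots$ are i.i.d. with $p_S(1)=\beta$, $0\le\beta<1$, and $$p_{Y|XS}(1|0,0)=\alpha,\qquad p_{Y|XS}(1|1,0)=1-\alpha,\qquad p_{Y|XS}(1|x,1)=1\quad(x\in\{0,1\}),$$ where $0\le\alpha\le 1$. The whole state vector is known in advance to the encoder, but not to the decoder. The input cost is $b(x)=x$; a code of block length $n$, used with a uniformly distributed message, must satisfy $\sum_{i=1}^n \mathsf{E}[b(X_i)]\le nB$, where $B\ge 0$. Let $\epsilon=B/(1-\beta)$, assume $\epsilon\le 1/2$, and write $\epsilon*\alpha=\epsilon(1-\alpha)+(1-\epsilon)\alpha$ and $h(p)=-p\log_2p-(1-p)\log_2(1-p)$. Then the capacity of this channel, i.e. the least upper bound of the rates (in bits per channel use) at which the average probability of decoding error can be made arbitrarily small for all large enough block lengths under the cost constraint, is $$C=(1-\beta)\,[h(\epsilon*\alpha)-h(\alpha)].$$ Moreover, the selections $\mathcal V=\{0,1\}$, $x(v,s)=v\wedge\neg s$ and $$p_{V|S}(1|0)=\epsilon,\qquad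 p_{V|S}(1|1)=\frac{\epsilon(1-\alpha)}{\epsilon*\alpha}$$ (where $0/0$ is read as $0$ in the degenerate case $\epsilon=\alpha=0$) achieve this capacity: with $X=x(V,S)$ they satisfy $\mathsf{E}[b(X)]\le B$ and $I(V;Y)-I(V;S)=C$, and they maximize $I(V;Y)-I(V;S)$ over all auxiliary random variables $V$ with a finite alphabet, all conditional pmfs $p(v|s)$ and all functions $x(v,s)$ with $\mathsf{E}[b(X)]\le B$. -/

import Mathlib

/-- A discrete memoryless channel with a discrete memoryless state and an input cost function:
`pS` is the state pmf, `W x s y` is the transition probability `p(y | x, s)`, and `cost` is the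
input cost function. -/
structure StateChannel (X S Y : Type) [Fintype S] [Fintype Y] where
  pS : S → ℝ
  pS_nonneg : ∀ s, 0 ≤ pS s
  pS_sum : ∑ s, pS s = 1
  W : X → S → Y → ℝ
  W_nonneg : ∀ x s y, 0 ≤ W x s y
  W_sum : ∀ x s, ∑ y, W x s y = 1
  cost : X → ℝ

/-- A block code of length `n` with `M` messages. The encoder knows the whole state vector
(non-causally); the decoder sees only the channel output. -/
structure StateCode (X S Y : Type) (n M : ℕ) where
  enc : Fin M → (Fin n → S) → (Fin n → X)
  dec : (Fin n → Y) → Fin M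

/-- The choice of a conditional pmf `p(v | s)` (written `p s v`) of an auxiliary random variable
with finite alphabet `V`, and of a function `x(v, s)`. -/
structure AuxChoice (V X S : Type) [Fintype V] where
  p : S → V → ℝ
  p_nonneg : ∀ s v, 0 ≤ p s v
  p_sum : ∀ s, ∑ v, p s v = 1
  x : V → S → X

/-- Mutual information, in bits, of a pair of random variables with joint pmf `P`. Terms with
`P a b = 0` vanish. -/
noncomputable def mutualInfoBits {A B : Type} [Fintype A] [Fintype B] (P : A → B → ℝ) : ℝ :=
  ∑ a, ∑ b, P a b * Real.logb 2 (P a b / ((∑ b', P a b') * (∑ a', P a' b)))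

namespace StateChannel

variable {X S Y : Type} [Fintype S] [Fintype Y]

/-- The average probability of decoding error: the message is uniform, the states are i.i.d.
with pmf `pS` and independent of the message, and the channel is memoryless. -/
noncomputable def errorProb (ch : StateChannel X S Y) {n M : ℕ} (c : StateCode X S Y n M) : ℝ :=
  (∑ m : Fin M, ∑ s : Fin n → S, ∑ y : Fin n → Y,
    (∏ i, ch.pS (s i)) * (∏ i, ch.W (c.enc m s i) (s i) (y i)) *
      (if c.dec y = m then 0 else 1)) / (M : ℝ)

/-- The expected total input cost `∑ i, E[b(X_i)]` of a code, for a uniform message and i.i.d.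
states. -/
noncomputable def expectedCost (ch : StateChannel X S Y) {n M : ℕ} (c : StateCode X S Y n M) : ℝ :=
  ∑ i : Fin n, (∑ m : Fin M, ∑ s : Fin n → S,
    (∏ j, ch.pS (s j)) * ch.cost (c.enc m s i)) / (M : ℝ)

/-- The rate `R` (in bits per channel use) is achievable under the cost constraint `B`: for every
`δ > 0` and every large enough block length `n` there is a code with at least `2 ^ (n R)` messages,
expected total input cost at most `n B`, and probability of decoding error at most `δ`. -/
def Achievable (ch : StateChannel X S Y) (B R : ℝ) : Prop :=
  ∀ δ : ℝ, 0 < δ → ∃ N : ℕ, ∀ n : ℕ, N ≤ n → ∃ (M : ℕ) (c : StateCode X S Y n M),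
    (2 : ℝ) ^ ((n : ℝ) * R) ≤ (M : ℝ) ∧ ch.expectedCost c ≤ (n : ℝ) * B ∧ ch.errorProb c ≤ δ

/-- `C` is the capacity with an informed encoder and input cost constraint `B`: the least upper
bound of the achievable rates. -/
def IsCapacity (ch : StateChannel X S Y) (B C : ℝ) : Prop :=
  IsLUB {R : ℝ | ch.Achievable B R} C

variable {V : Type} [Fintype V]

/-- The joint pmf of `(V, S)`. -/
def jointVS (ch : StateChannel X S Y) (a : AuxChoice V X S) (v : V) (s : S) : ℝ :=
  ch.pS s * a.p s v

/-- The joint pmf of `(V, Y)` when `X = x(V, S)`. -/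
def jointVY (ch : StateChannel X S Y) (a : AuxChoice V X S) (v : V) (y : Y) : ℝ :=
  ∑ s, ch.pS s * a.p s v * ch.W (a.x v s) s y

/-- The expected input cost `E[b(X)]` when `X = x(V, S)`. -/
def auxCost (ch : StateChannel X S Y) (a : AuxChoice V X S) : ℝ :=
  ∑ s, ∑ v, ch.pS s * a.p s v * ch.cost (a.x v s)

/-- The Gelfand-Pinsker rate `I(V; Y) - I(V; S)`. -/
noncomputable def gpRate (ch : StateChannel X S Y) (a : AuxChoice V X S) : ℝ :=
  mutualInfoBits (ch.jointVY a) - mutualInfoBits (ch.jointVS a)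

/-- The choice `a` maximizes the Gelfand-Pinsker rate subject to `E[b(X)] ≤ B`, among all choices
with an auxiliary random variable of arbitrary finite alphabet. -/
def IsGPMaximizer (ch : StateChannel X S Y) (B : ℝ) (a : AuxChoice V X S) : Prop :=
  ch.auxCost a ≤ B ∧
    ∀ (V' : Type) [Fintype V'] (a' : AuxChoice V' X S), ch.auxCost a' ≤ B →
      ch.gpRate a' ≤ ch.gpRate a

end StateChannel

/-- The binary entropy function in bits. -/
noncomputable def binEntropyBits (p : ℝ) : ℝ := Real.binEntropy p / Real.log 2

/-- Binary convolution `a * b = a (1 - b) + (1 - a) b`. -/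
def binConv (a b : ℝ) : ℝ := a * (1 - b) + (1 - a) * b

/-- The pmf on `Bool` that gives probability `p` to `true`. -/
def bernoulliPmf (p : ℝ) (y : Bool) : ℝ := if y then p else 1 - p

theorem bernoulliPmf_nonneg {p : ℝ} (hp : p ∈ Set.Icc (0 : ℝ) 1) (y : Bool) :
    0 ≤ bernoulliPmf p y := by
  obtain ⟨h0, h1⟩ := hp
  cases y <;> simp [bernoulliPmf] <;> linarith

theorem bernoulliPmf_sum (p : ℝ) : ∑ y, bernoulliPmf p y = 1 := by
  simp [bernoulliPmf]

/-- The probability that the output is `1` for input `x` and state `s` in the binary write-once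
memory with writing noise. -/
def womOne (α : ℝ) (x s : Bool) : ℝ := if s then 1 else if x then 1 - α else α

theorem womOne_mem {α : ℝ} (hα : α ∈ Set.Icc (0 : ℝ) 1) (x s : Bool) :
    womOne α x s ∈ Set.Icc (0 : ℝ) 1 := by
  obtain ⟨h0, h1⟩ := hα
  cases x <;> cases s <;> simp [womOne] <;> constructor <;> linarith

/-- The binary write-once memory with writing noise: the state is `1` with probability `β`; in
state `1` the output is always `1`, and in state `0` the channel is a binary symmetric channel with
crossover probability `α`. The cost function is `b(x) = x`. -/
def noisyWOM (α β : ℝ) (hα : α ∈ Set.Icc (0 : ℝ) 1) (hβ : β ∈ Set.Icc (0 : ℝ) 1) :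
    StateChannel Bool Bool Bool where
  pS := bernoulliPmf β
  pS_nonneg := bernoulliPmf_nonneg hβ
  pS_sum := bernoulliPmf_sum β
  W x s := bernoulliPmf (womOne α x s)
  W_nonneg x s := bernoulliPmf_nonneg (womOne_mem hα x s)
  W_sum x s := bernoulliPmf_sum (womOne α x s)
  cost x := if x then 1 else 0

/-- The sum over all vectors of a product of one-coordinate functions. -/
theorem sum_pi_prod {ι Z : Type} [Fintype ι] [DecidableEq ι] [Fintype Z] (f : ι → Z → ℝ) :
    ∑ z : ι → Z, ∏ i, f i (z i) = ∏ i, ∑ z, f i z := by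
  classical
  rw [Finset.prod_univ_sum, Fintype.piFinset_univ]

theorem sum_pi_prod_eq_one {ι Z : Type} [Fintype ι] [DecidableEq ι] [Fintype Z] {p : ι → Z → ℝ}
    (hp : ∀ i, ∑ z, p i z = 1) : ∑ z : ι → Z, ∏ i, p i (z i) = 1 := by
  rw [sum_pi_prod]; simp [hp]

/-- Expectation of the product of functions of two different coordinates under a product pmf. -/
theorem sum_pi_prod_mul_mul {ι Z : Type} [Fintype ι] [DecidableEq ι] [Fintype Z] {p : ι → Z → ℝ}
    (hp : ∀ i, ∑ z, p i z = 1) {i j : ι} (hij : i ≠ j) (f g : Z → ℝ) :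
    ∑ z : ι → Z, (∏ k, p k (z k)) * (f (z i) * g (z j))
      = (∑ z, p i z * f z) * ∑ z, p j z * g z := by
  have h : ∀ z : ι → Z, (∏ k, p k (z k)) * (f (z i) * g (z j))
      = ∏ k, p k (z k) * ((if k = i then f (z k) else 1) * (if k = j then g (z k) else 1)) := by
    intro z
    simp only [Finset.prod_mul_distrib, Finset.prod_ite_eq', Finset.mem_univ, if_true]
  simp only [h]
  rw [sum_pi_prod (fun k z ↦ p k z * ((if k = i then f z else 1) * (if k = j then g z else 1)))]
  rw [← Finset.mul_prod_erase _ _ (Finset.mem_univ i),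
    ← Finset.mul_prod_erase _ _ (Finset.mem_erase.2 ⟨hij.symm, Finset.mem_univ j⟩),
    Finset.prod_eq_one (s := (Finset.univ.erase i).erase j)]
  · simp [hij, hij.symm]
  · intro k hk
    simp only [Finset.mem_erase] at hk
    simp [hk.1, hk.2.1, hp]

/-- Expectation of a function of one coordinate under a product pmf. -/
theorem sum_pi_prod_mul {ι Z : Type} [Fintype ι] [DecidableEq ι] [Fintype Z] {p : ι → Z → ℝ}
    (hp : ∀ i, ∑ z, p i z = 1) (i : ι) (f : Z → ℝ) :
    ∑ z : ι → Z, (∏ k, p k (z k)) * f (z i) = ∑ z, p i z * f z := by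
  have h : ∀ z : ι → Z, (∏ k, p k (z k)) * f (z i)
      = ∏ k, p k (z k) * (if k = i then f (z k) else 1) := by
    intro z
    simp only [Finset.prod_mul_distrib, Finset.prod_ite_eq', Finset.mem_univ, if_true]
  simp only [h]
  rw [sum_pi_prod (fun k z ↦ p k z * (if k = i then f z else 1)),
    ← Finset.mul_prod_erase _ _ (Finset.mem_univ i), Finset.prod_eq_one (s := Finset.univ.erase i)]
  · simp
  · intro k hk
    simp only [Finset.mem_erase] at hk
    simp [hk.1, hp]

/-- The second moment of a sum of centred functions of independent coordinates. -/
theorem sum_pi_prod_mul_sq {Z : Type} [Fintype Z] {p : Z → ℝ} (hp : ∑ z, p z = 1) {g : Z → ℝ}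
    (hg : ∑ z, p z * g z = 0) (n : ℕ) :
    ∑ z : Fin n → Z, (∏ k, p (z k)) * (∑ i, g (z i)) ^ 2 = n * ∑ z, p z * g z ^ 2 := by
  have h : ∀ z : Fin n → Z, (∏ k, p (z k)) * (∑ i, g (z i)) ^ 2
      = ∑ i, ∑ j, (∏ k, p (z k)) * (g (z i) * g (z j)) := by
    intro z
    rw [sq, Finset.sum_mul_sum, Finset.mul_sum]
    simp only [Finset.mul_sum]
  simp only [h]
  rw [Finset.sum_comm]
  have h2 : ∀ i : Fin n, ∑ z : Fin n → Z, ∑ j, (∏ k, p (z k)) * (g (z i) * g (z j))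
      = ∑ z, p z * g z ^ 2 := by
    intro i
    rw [Finset.sum_comm, Finset.sum_eq_single i]
    · simpa only [sq] using sum_pi_prod_mul (p := fun _ ↦ p) (fun _ ↦ hp) i (fun z ↦ g z * g z)
    · intro j _ hj
      rw [sum_pi_prod_mul_mul (p := fun _ ↦ p) (fun _ ↦ hp) hj.symm, hg, zero_mul]
    · simp
  simp [h2]

open Classical in
/-- Weak law of large numbers for a product pmf on a finite alphabet. -/
theorem weak_law {Z : Type} [Fintype Z] {p : Z → ℝ} (hp0 : ∀ z, 0 ≤ p z) (hp : ∑ z, p z = 1)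
    (f : Z → ℝ) {δ η : ℝ} (hδ : 0 < δ) (hη : 0 < η) :
    ∃ N : ℕ, ∀ n : ℕ, N ≤ n → ∑ z : Fin n → Z, (∏ k, p (z k)) *
      (if n * δ ≤ |∑ i, f (z i) - n * ∑ w, p w * f w| then 1 else 0) ≤ η := by
  set μ := ∑ w, p w * f w
  set v := ∑ z, p z * (f z - μ) ^ 2 with hv
  have hg : ∑ z, p z * (f z - μ) = 0 := by
    simp only [mul_sub, Finset.sum_sub_distrib, ← Finset.sum_mul, hp]
    simp [μ]
  obtain ⟨N, hN⟩ := exists_nat_ge (v / (δ ^ 2 * η))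
  refine ⟨N + 1, fun n hn ↦ ?_⟩
  have hn0 : (0 : ℝ) < n := by
    have : 0 < n := by omega
    exact_mod_cast this
  have hnN : v / (δ ^ 2 * η) ≤ n := hN.trans (by exact_mod_cast (by omega : N ≤ n))
  rw [div_le_iff₀ (by positivity)] at hnN
  have key := sum_pi_prod_mul_sq hp hg n
  rw [← hv] at key
  have hpt : ∀ z : Fin n → Z, (∏ k, p (z k)) *
      (if n * δ ≤ |∑ i, f (z i) - n * μ| then 1 else 0)
      ≤ (∏ k, p (z k)) * (∑ i, (f (z i) - μ)) ^ 2 / (n * δ) ^ 2 := by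
    intro z
    have h0 : 0 ≤ ∏ k, p (z k) := Finset.prod_nonneg fun _ _ ↦ hp0 _
    rw [mul_div_assoc]
    refine mul_le_mul_of_nonneg_left ?_ h0
    split_ifs with h
    · rw [le_div_iff₀ (by positivity), one_mul]
      have : ∑ i, (f (z i) - μ) = ∑ i, f (z i) - n * μ := by simp [Finset.sum_sub_distrib]
      rw [this, ← sq_abs (∑ i, f (z i) - n * μ)]
      gcongr
    · positivity
  refine (Finset.sum_le_sum fun z _ ↦ hpt z).trans ?_
  rw [← Finset.sum_div, key, div_le_iff₀ (by positivity)]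
  nlinarith

/-- Some value of a function is at most any upper bound of its mean. -/
theorem exists_le_of_mean_le {Z : Type} [Fintype Z] {p : Z → ℝ} (hp0 : ∀ z, 0 ≤ p z)
    (hp : ∑ z, p z = 1) {f : Z → ℝ} {b : ℝ} (h : ∑ z, p z * f z ≤ b) : ∃ z, f z ≤ b := by
  by_contra! hlt
  have h1 : ∑ z, p z * (f z - b) ≤ 0 := by
    simp only [mul_sub, Finset.sum_sub_distrib, ← Finset.sum_mul, hp]
    linarith
  have h2 : ∀ z ∈ Finset.univ, 0 ≤ p z * (f z - b) := fun z _ ↦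
    mul_nonneg (hp0 z) (by linarith [hlt z])
  have h3 := (Finset.sum_eq_zero_iff_of_nonneg h2).1 (le_antisymm h1 (Finset.sum_nonneg h2))
  have h4 : ∀ z, p z = 0 := fun z ↦ by
    have := h3 z (Finset.mem_univ z)
    rcases mul_eq_zero.1 this with h | h
    · exact h
    · linarith [hlt z]
  simp [h4] at hp

section Binning

variable {V S X Y : Type} {M K : ℕ}

open Classical in
/-- The channel input of the binning encoder: `φ v s` for some codeword `v` of the row that is
compatible with the state `s`, and `x₀` if there is none. -/
noncomputable def rowInput (A : V → S → Prop) (φ : V → S → X) (x₀ : X) (r : Fin K → V) (s : S) :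
    X :=
  if h : ∃ k, A (r k) s then φ (r h.choose) s else x₀

open Classical in
/-- The decoder of a binned codebook: some message whose row contains a codeword that passes the
test `T` for the received `y`. -/
noncomputable def rowDecode (T : V → Y → Prop) (m₀ : Fin M) (C : Fin M → Fin K → V) (y : Y) :
    Fin M :=
  if h : ∃ m, ∃ k, T (C m k) y then h.choose else m₀

theorem rowInput_eq (A : V → S → Prop) (φ : V → S → X) (x₀ : X) (r : Fin K → V) (s : S) :
    rowInput A φ x₀ r s = x₀ ∨ ∃ v, A v s ∧ rowInput A φ x₀ r s = φ v s := by
  by_cases h : ∃ k, A (r k) s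
  · exact Or.inr ⟨r h.choose, h.choose_spec, by rw [rowInput, dif_pos h]⟩
  · exact Or.inl (by rw [rowInput, dif_neg h])

open Classical in
theorem rowDecode_ne_le (T : V → Y → Prop) (m₀ : Fin M) (C : Fin M → Fin K → V) (y : Y)
    (m : Fin M) :
    (if rowDecode T m₀ C y = m then (0 : ℝ) else 1) ≤ (if ∃ k, T (C m k) y then 0 else 1)
      + ∑ m' ∈ Finset.univ.erase m, ∑ k, if T (C m' k) y then 1 else 0 := by
  have hnn : (0 : ℝ) ≤ ∑ m' ∈ Finset.univ.erase m, ∑ k, if T (C m' k) y then 1 else 0 :=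
    Finset.sum_nonneg fun _ _ ↦ Finset.sum_nonneg fun _ _ ↦ by split_ifs <;> norm_num
  by_cases hd : rowDecode T m₀ C y = m
  · rw [if_pos hd]
    refine add_nonneg ?_ hnn
    split_ifs <;> norm_num
  rw [if_neg hd]
  by_cases hm : ∃ k, T (C m k) y
  · have h : ∃ m, ∃ k, T (C m k) y := ⟨m, hm⟩
    have hdec : rowDecode T m₀ C y = h.choose := by rw [rowDecode, dif_pos h]
    obtain ⟨k, hk⟩ := h.choose_spec
    rw [← hdec] at hk
    have h1 : (1 : ℝ) ≤ ∑ k, if T (C (rowDecode T m₀ C y) k) y then 1 else 0 := by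
      refine le_trans ?_ (Finset.single_le_sum (f := fun k ↦
        if T (C (rowDecode T m₀ C y) k) y then (1 : ℝ) else 0)
        (fun _ _ ↦ by split_ifs <;> norm_num) (Finset.mem_univ k))
      simp [hk]
    have h2 := Finset.single_le_sum (s := Finset.univ.erase m) (f := fun m' ↦
      ∑ k, if T (C m' k) y then (1 : ℝ) else 0)
      (fun _ _ ↦ Finset.sum_nonneg fun _ _ ↦ by split_ifs <;> norm_num)
      (Finset.mem_erase.2 ⟨hd, Finset.mem_univ _⟩)
    rw [if_pos hm]
    linarith
  · rw [if_neg hm]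
    linarith

variable [Fintype Y]

open Classical in
/-- The error probability of a binned codebook for given message and state. -/
theorem sum_rowDecode_ne_le {W : X → S → Y → ℝ} (hW0 : ∀ x s y, 0 ≤ W x s y)
    (hW : ∀ x s, ∑ y, W x s y = 1) (φ : V → S → X) (x₀ : X) (A : V → S → Prop) (T : V → Y → Prop)
    {η : ℝ} (hη : 0 ≤ η)
    (hA : ∀ v s, A v s → ∑ y, W (φ v s) s y * (if T v y then 0 else 1) ≤ η)
    (m₀ : Fin M) (C : Fin M → Fin K → V) (m : Fin M) (s : S) :
    ∑ y, W (rowInput A φ x₀ (C m) s) s y * (if rowDecode T m₀ C y = m then 0 else 1)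
      ≤ (∏ k, if A (C m k) s then 0 else 1) + η
        + ∑ m' ∈ Finset.univ.erase m, ∑ y, W (rowInput A φ x₀ (C m) s) s y *
            ∑ k, if T (C m' k) y then 1 else 0 := by
  set x := rowInput A φ x₀ (C m) s with hx
  have h1 : ∑ y, W x s y * (if ∃ k, T (C m k) y then 0 else 1)
      ≤ (∏ k, if A (C m k) s then (0 : ℝ) else 1) + η := by
    by_cases h : ∃ k, A (C m k) s
    · have hx' : x = φ (C m h.choose) s := by rw [hx, rowInput, dif_pos h]
      have hp : (0 : ℝ) ≤ ∏ k, if A (C m k) s then (0 : ℝ) else 1 :=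
        Finset.prod_nonneg fun _ _ ↦ by split_ifs <;> norm_num
      have := hA _ _ h.choose_spec
      rw [← hx'] at this
      refine le_trans (Finset.sum_le_sum fun y _ ↦ mul_le_mul_of_nonneg_left ?_ (hW0 _ _ _))
        (this.trans (by linarith))
      by_cases hT : T (C m h.choose) y
      · rw [if_pos hT, if_pos ⟨_, hT⟩]
      · rw [if_neg hT]; split_ifs <;> norm_num
    · push Not at h
      have hp : (∏ k, if A (C m k) s then (0 : ℝ) else 1) = 1 := by simp [h]
      have : ∑ y, W x s y * (if ∃ k, T (C m k) y then 0 else 1) ≤ ∑ y, W x s y :=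
        Finset.sum_le_sum fun y _ ↦ mul_le_of_le_one_right (hW0 _ _ _) (by split_ifs <;> norm_num)
      rw [hp]
      linarith [hW x s]
  calc ∑ y, W x s y * (if rowDecode T m₀ C y = m then 0 else 1)
      ≤ ∑ y, W x s y * ((if ∃ k, T (C m k) y then 0 else 1)
        + ∑ m' ∈ Finset.univ.erase m, ∑ k, if T (C m' k) y then 1 else 0) :=
        Finset.sum_le_sum fun y _ ↦
          mul_le_mul_of_nonneg_left (rowDecode_ne_le T m₀ C y m) (hW0 _ _ _)
    _ = ∑ y, W x s y * (if ∃ k, T (C m k) y then 0 else 1)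
        + ∑ m' ∈ Finset.univ.erase m, ∑ y, W x s y * ∑ k, if T (C m' k) y then 1 else 0 := by
        simp only [mul_add, Finset.sum_add_distrib]
        congr 1
        rw [Finset.sum_comm]
        simp only [Finset.mul_sum]
    _ ≤ _ := by linarith

open Classical in
/-- Random binning: a code for a channel with informed encoder, from a pmf `Q` of the codewords, a
compatibility relation `A` of codewords and states, and a decoding test `T`. -/
theorem exists_binning_code [Fintype V] [Fintype S]
    {Q : V → ℝ} (hQ0 : ∀ v, 0 ≤ Q v) (hQ : ∑ v, Q v = 1)
    {P : S → ℝ} (hP0 : ∀ s, 0 ≤ P s) (hP : ∑ s, P s = 1)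
    {W : X → S → Y → ℝ} (hW0 : ∀ x s y, 0 ≤ W x s y) (hW : ∀ x s, ∑ y, W x s y = 1)
    (φ : V → S → X) (x₀ : X) (A : V → S → Prop) (T : V → Y → Prop) {η τ : ℝ} (hη : 0 ≤ η)
    (hA : ∀ v s, A v s → ∑ y, W (φ v s) s y * (if T v y then 0 else 1) ≤ η)
    (hT : ∀ y, ∑ v, Q v * (if T v y then 1 else 0) ≤ τ) (hM : 0 < M) (K : ℕ) :
    ∃ (enc : Fin M → S → X) (dec : Y → Fin M),
      (∀ m s, enc m s = x₀ ∨ ∃ v, A v s ∧ enc m s = φ v s) ∧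
      ∑ m, ∑ s, ∑ y, P s * W (enc m s) s y * (if dec y = m then 0 else 1)
        ≤ M * (∑ s, P s * (1 - ∑ v, Q v * (if A v s then 1 else 0)) ^ K + η + M * (K * τ)) := by
  have hρ0 : ∀ r : Fin K → V, 0 ≤ ∏ k, Q (r k) := fun r ↦ Finset.prod_nonneg fun _ _ ↦ hQ0 _
  have hρ : ∑ r : Fin K → V, ∏ k, Q (r k) = 1 := sum_pi_prod_eq_one (fun _ ↦ hQ)
  set ρ : (Fin K → V) → ℝ := fun r ↦ ∏ k, Q (r k) with hρdef
  have hC0 : ∀ C : Fin M → Fin K → V, 0 ≤ ∏ m, ρ (C m) := fun C ↦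
    Finset.prod_nonneg fun _ _ ↦ hρ0 _
  have hC : ∑ C : Fin M → Fin K → V, ∏ m, ρ (C m) = 1 := sum_pi_prod_eq_one (fun _ ↦ hρ)
  let m₀ : Fin M := ⟨0, hM⟩
  have hcover : ∀ s, ∑ r, ρ r * (∏ k, if A (r k) s then (0 : ℝ) else 1)
      = (1 - ∑ v, Q v * (if A v s then 1 else 0)) ^ K := by
    intro s
    simp only [hρdef, ← Finset.prod_mul_distrib]
    rw [sum_pi_prod (fun _ v ↦ Q v * (if A v s then (0 : ℝ) else 1)), Finset.prod_const,
      Finset.card_univ, Fintype.card_fin]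
    congr 1
    rw [eq_sub_iff_add_eq, ← Finset.sum_add_distrib]
    exact (Finset.sum_congr rfl fun v _ ↦ by split_ifs <;> ring).trans hQ
  have hpack : ∀ y, ∑ r, ρ r * (∑ k, if T (r k) y then (1 : ℝ) else 0) ≤ K * τ := by
    intro y
    simp only [hρdef, Finset.mul_sum]
    rw [Finset.sum_comm]
    refine (Finset.sum_le_sum fun k _ ↦ ?_).trans (b := ∑ _ : Fin K, τ) (by simp)
    rw [sum_pi_prod_mul (p := fun _ ↦ Q) (fun _ ↦ hQ) k (fun v ↦ if T v y then (1 : ℝ) else 0)]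
    exact hT y
  have hmean : ∑ C : Fin M → Fin K → V, (∏ m, ρ (C m)) *
      (∑ m, ∑ s, P s * ((∏ k, if A (C m k) s then 0 else 1) + η
        + ∑ m' ∈ Finset.univ.erase m, ∑ y, W (rowInput A φ x₀ (C m) s) s y *
            ∑ k, if T (C m' k) y then 1 else 0))
      ≤ M * (∑ s, P s * (1 - ∑ v, Q v * (if A v s then 1 else 0)) ^ K + η + M * (K * τ)) := by
    have hms : ∀ (m : Fin M) (s : S), ∑ C : Fin M → Fin K → V, (∏ m, ρ (C m)) *
        ((∏ k, if A (C m k) s then 0 else 1) + η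
        + ∑ m' ∈ Finset.univ.erase m, ∑ y, W (rowInput A φ x₀ (C m) s) s y *
            ∑ k, if T (C m' k) y then 1 else 0)
        ≤ (1 - ∑ v, Q v * (if A v s then 1 else 0)) ^ K + η + M * (K * τ) := by
      intro m s
      simp only [mul_add, Finset.sum_add_distrib, ← Finset.sum_mul, hC, one_mul]
      rw [sum_pi_prod_mul (p := fun _ ↦ ρ) (fun _ ↦ hρ) m
        (fun r ↦ ∏ k, if A (r k) s then (0 : ℝ) else 1), hcover]
      gcongr
      simp only [Finset.mul_sum (s := Finset.univ.erase m)]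
      rw [Finset.sum_comm]
      have hτ : 0 ≤ K * τ := by
        obtain ⟨y⟩ : Nonempty Y := by
          by_contra hY
          rw [not_nonempty_iff] at hY
          simpa using hW x₀ s
        refine le_trans (Finset.sum_nonneg fun r _ ↦ mul_nonneg (hρ0 r) ?_) (hpack y)
        exact Finset.sum_nonneg fun _ _ ↦ by split_ifs <;> norm_num
      refine (Finset.sum_le_sum (g := fun _ ↦ K * τ) fun m' hm' ↦ ?_).trans ?_
      · simp only [Finset.mul_sum (s := (Finset.univ : Finset Y))]
        rw [Finset.sum_comm]
        have hne : m ≠ m' := (Finset.ne_of_mem_erase hm').symm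
        have h1 : ∀ y, ∑ C : Fin M → Fin K → V, (∏ m, ρ (C m)) *
            (W (rowInput A φ x₀ (C m) s) s y * ∑ k, if T (C m' k) y then 1 else 0)
            ≤ (∑ r, ρ r * W (rowInput A φ x₀ r s) s y) * (K * τ) := by
          intro y
          rw [sum_pi_prod_mul_mul (p := fun _ ↦ ρ) (fun _ ↦ hρ) hne
            (fun r ↦ W (rowInput A φ x₀ r s) s y) (fun r ↦ ∑ k, if T (r k) y then (1 : ℝ) else 0)]
          exact mul_le_mul_of_nonneg_left (hpack y)
            (Finset.sum_nonneg fun r _ ↦ mul_nonneg (hρ0 r) (hW0 _ _ _))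
        refine (Finset.sum_le_sum fun y _ ↦ h1 y).trans (le_of_eq ?_)
        rw [← Finset.sum_mul, Finset.sum_comm]
        simp only [← Finset.mul_sum, hW, mul_one]
        rw [hρ, one_mul]
      · rw [Finset.sum_const, nsmul_eq_mul]
        refine mul_le_mul_of_nonneg_right ?_ hτ
        exact_mod_cast (Finset.card_le_univ _).trans (by simp)
    have hm : ∀ m : Fin M, ∑ C : Fin M → Fin K → V, (∏ m, ρ (C m)) *
        (∑ s, P s * ((∏ k, if A (C m k) s then 0 else 1) + η
        + ∑ m' ∈ Finset.univ.erase m, ∑ y, W (rowInput A φ x₀ (C m) s) s y *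
            ∑ k, if T (C m' k) y then 1 else 0))
        ≤ ∑ s, P s * (1 - ∑ v, Q v * (if A v s then 1 else 0)) ^ K + η + M * (K * τ) := by
      intro m
      simp only [Finset.mul_sum (s := (Finset.univ : Finset S)), mul_left_comm _ (P _)]
      rw [Finset.sum_comm]
      simp only [← Finset.mul_sum]
      refine (Finset.sum_le_sum fun s _ ↦ mul_le_mul_of_nonneg_left (hms m s) (hP0 s)).trans ?_
      simp only [mul_add, Finset.sum_add_distrib, ← Finset.sum_mul, hP, one_mul]
      exact le_rfl
    simp only [Finset.mul_sum (s := (Finset.univ : Finset (Fin M)))]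
    rw [Finset.sum_comm]
    refine (Finset.sum_le_sum fun m _ ↦ hm m).trans (le_of_eq ?_)
    rw [Finset.sum_const, Finset.card_univ, Fintype.card_fin, nsmul_eq_mul]
  obtain ⟨C, hCle⟩ := exists_le_of_mean_le hC0 hC hmean
  refine ⟨fun m s ↦ rowInput A φ x₀ (C m) s, rowDecode T m₀ C,
    fun m s ↦ rowInput_eq A φ x₀ (C m) s, le_trans ?_ hCle⟩
  refine Finset.sum_le_sum fun m _ ↦ Finset.sum_le_sum fun s _ ↦ ?_
  simp only [mul_assoc]
  rw [← Finset.mul_sum]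
  exact mul_le_mul_of_nonneg_left
    (sum_rowDecode_ne_le hW0 hW φ x₀ A T hη hA m₀ C m s) (hP0 s)

end Binning

theorem sum_pi_prod_type {ι A B : Type} [Fintype ι] [DecidableEq ι] [Fintype A] [Fintype B]
    (F : (ι → A × B) → ℝ) : ∑ z, F z = ∑ a : ι → A, ∑ b : ι → B, F (fun i ↦ (a i, b i)) := by
  rw [← Fintype.sum_prod_type']
  exact (Equiv.sum_comp (Equiv.arrowProdEquivProdArrow ι (fun _ ↦ A) (fun _ ↦ B)).symm F).symm

theorem prod_eq_exp_sum_log_mul_prod {ι : Type} [Fintype ι] {u w : ι → ℝ} (hu : ∀ i, 0 < u i)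
    (hw : ∀ i, 0 < w i) : ∏ i, u i = Real.exp (∑ i, Real.log (u i / w i)) * ∏ i, w i := by
  rw [Real.exp_sum, ← Finset.prod_mul_distrib]
  refine Finset.prod_congr rfl fun i _ ↦ ?_
  rw [Real.exp_log (div_pos (hu i) (hw i)), div_mul_cancel₀ _ (hw i).ne']

theorem pos_of_prod_ne_zero {ι : Type} [Fintype ι] {u : ι → ℝ} (hu : ∀ i, 0 ≤ u i)
    (h : ∏ i, u i ≠ 0) (i : ι) : 0 < u i :=
  (hu i).lt_of_ne' (Finset.prod_ne_zero_iff.1 h i (Finset.mem_univ i))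

open Classical in
/-- The covering estimate: the mean probability that none of `K` independent codewords with pmf `Q`
is compatible with the state, when `A` bounds the likelihood ratio of `p` and `Q` by `G`. -/
theorem sum_mul_one_sub_pow_le {V S : Type} [Fintype V] [Fintype S] {Q : V → ℝ}
    (hQ0 : ∀ v, 0 ≤ Q v) (hQ : ∑ v, Q v = 1) {P : S → ℝ} (hP0 : ∀ s, 0 ≤ P s)
    (hP : ∑ s, P s = 1) {p : S → V → ℝ} (hp0 : ∀ s v, 0 ≤ p s v) (hp : ∀ s, ∑ v, p s v = 1)
    {A : V → S → Prop} {G : ℝ} (hG : 0 < G) (hA : ∀ v s, A v s → p s v ≤ G * Q v) (K : ℕ) :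
    ∑ s, P s * (1 - ∑ v, Q v * (if A v s then 1 else 0)) ^ K
      ≤ ∑ v, ∑ s, P s * p s v * (if A v s then 0 else 1) + Real.exp (-(K / G)) := by
  have key : ∀ s, (1 - ∑ v, Q v * (if A v s then 1 else 0)) ^ K
      ≤ ∑ v, p s v * (if A v s then 0 else 1) + Real.exp (-(K / G)) := by
    intro s
    set a := ∑ v, Q v * (if A v s then 1 else 0) with ha
    set π := ∑ v, p s v * (if A v s then 1 else 0) with hπ
    have ha1 : a ≤ 1 := by
      rw [← hQ]
      exact Finset.sum_le_sum fun v _ ↦ mul_le_of_le_one_right (hQ0 v) (by split_ifs <;> norm_num)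
    have hπ0 : 0 ≤ π :=
      Finset.sum_nonneg fun v _ ↦ mul_nonneg (hp0 s v) (by split_ifs <;> norm_num)
    have hπ1 : π ≤ 1 := by
      rw [← hp s]
      exact Finset.sum_le_sum fun v _ ↦
        mul_le_of_le_one_right (hp0 s v) (by split_ifs <;> norm_num)
    have hπa : π ≤ G * a := by
      rw [ha, Finset.mul_sum]
      refine Finset.sum_le_sum fun v _ ↦ ?_
      split_ifs with h
      · simpa using hA v s h
      · simp
    have hcompl : ∑ v, p s v * (if A v s then 0 else 1) = 1 - π := by
      rw [eq_sub_iff_add_eq, hπ, ← Finset.sum_add_distrib]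
      exact (Finset.sum_congr rfl fun v _ ↦ by split_ifs <;> ring).trans (hp s)
    have h1 : (1 - a) ^ K ≤ Real.exp (-a) ^ K :=
      pow_le_pow_left₀ (by linarith) (by linarith [Real.add_one_le_exp (-a)]) K
    have h2 : Real.exp (-a) ^ K ≤ Real.exp (-(K / G) * π) := by
      rw [← Real.exp_nat_mul]
      refine Real.exp_le_exp.2 ?_
      have : K / G * π ≤ K * a := by
        rw [div_mul_eq_mul_div, div_le_iff₀ hG]
        nlinarith [Nat.cast_nonneg (α := ℝ) K]
      linarith
    have h3 := convexOn_exp.2 (Set.mem_univ (0 : ℝ)) (Set.mem_univ (-(K / G) : ℝ))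
      (by linarith : 0 ≤ 1 - π) hπ0 (by ring)
    simp only [smul_eq_mul, mul_zero, zero_add, Real.exp_zero, mul_one] at h3
    rw [mul_comm π] at h3
    have h4 : π * Real.exp (-(K / G)) ≤ Real.exp (-(K / G)) :=
      mul_le_of_le_one_left (Real.exp_pos _).le hπ1
    rw [hcompl]
    linarith
  refine (Finset.sum_le_sum fun s _ ↦ mul_le_mul_of_nonneg_left (key s) (hP0 s)).trans (le_of_eq ?_)
  simp only [mul_add, Finset.sum_add_distrib, ← Finset.sum_mul, hP, one_mul]
  rw [Finset.sum_comm (s := (Finset.univ : Finset V))]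
  simp only [Finset.mul_sum, mul_assoc]

theorem mutualInfoBits_mul_log {A B : Type} [Fintype A] [Fintype B] (P : A → B → ℝ) :
    mutualInfoBits P * Real.log 2
      = ∑ a, ∑ b, P a b * Real.log (P a b / ((∑ b', P a b') * ∑ a', P a' b)) := by
  have : Real.log 2 ≠ 0 := (Real.log_pos one_lt_two).ne'
  rw [mutualInfoBits, Finset.sum_mul]
  refine Finset.sum_congr rfl fun a _ ↦ ?_
  rw [Finset.sum_mul]
  refine Finset.sum_congr rfl fun b _ ↦ ?_
  rw [Real.logb, mul_assoc, div_mul_cancel₀ _ this]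

theorem mutualInfoBits_nonneg {A B : Type} [Fintype A] [Fintype B] {P : A → B → ℝ}
    (hP0 : ∀ a b, 0 ≤ P a b) (hP : ∑ a, ∑ b, P a b = 1) : 0 ≤ mutualInfoBits P := by
  have hlog : 0 < Real.log 2 := Real.log_pos one_lt_two
  refine nonneg_of_mul_nonneg_left (b := Real.log 2) ?_ hlog
  rw [mutualInfoBits_mul_log]
  have h : ∀ a b, P a b - (∑ b', P a b') * ∑ a', P a' b
      ≤ P a b * Real.log (P a b / ((∑ b', P a b') * ∑ a', P a' b)) := by
    intro a b
    rcases (hP0 a b).eq_or_lt with h0 | h0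
    · rw [← h0]
      have : 0 ≤ (∑ b', P a b') * ∑ a', P a' b :=
        mul_nonneg (Finset.sum_nonneg fun _ _ ↦ hP0 _ _) (Finset.sum_nonneg fun _ _ ↦ hP0 _ _)
      simpa using this
    · have h1 : 0 < ∑ b', P a b' :=
        h0.trans_le (Finset.single_le_sum (f := P a) (fun b _ ↦ hP0 a b) (Finset.mem_univ b))
      have h2 : 0 < ∑ a', P a' b :=
        h0.trans_le (Finset.single_le_sum (f := fun a ↦ P a b) (fun a _ ↦ hP0 a b)
          (Finset.mem_univ a))
      have h3 := Real.one_sub_inv_le_log_of_pos (div_pos h0 (mul_pos h1 h2))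
      have h4 := mul_le_mul_of_nonneg_left h3 h0.le
      rw [inv_div, mul_sub, mul_one, mul_div_cancel₀ _ h0.ne'] at h4
      exact h4
  refine le_trans (le_of_eq ?_) (Finset.sum_le_sum fun a _ ↦ Finset.sum_le_sum fun b _ ↦ h a b)
  simp only [Finset.sum_sub_distrib, ← Finset.mul_sum, ← Finset.sum_mul, hP]
  rw [Finset.sum_comm, hP]
  norm_num

namespace StateChannel

variable {V X S Y : Type} [Fintype V] [Fintype S] [Fintype Y]

theorem jointVS_nonneg (ch : StateChannel X S Y) (a : AuxChoice V X S) (v : V) (s : S) :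
    0 ≤ ch.jointVS a v s :=
  mul_nonneg (ch.pS_nonneg s) (a.p_nonneg s v)

theorem jointVY_nonneg (ch : StateChannel X S Y) (a : AuxChoice V X S) (v : V) (y : Y) :
    0 ≤ ch.jointVY a v y :=
  Finset.sum_nonneg fun s _ ↦ mul_nonneg (ch.jointVS_nonneg a v s) (ch.W_nonneg _ _ _)

theorem sum_jointVS_left (ch : StateChannel X S Y) (a : AuxChoice V X S) (s : S) :
    ∑ v, ch.jointVS a v s = ch.pS s := by
  simp only [jointVS, ← Finset.mul_sum, a.p_sum, mul_one]

theorem sum_jointVS (ch : StateChannel X S Y) (a : AuxChoice V X S) :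
    ∑ v, ∑ s, ch.jointVS a v s = 1 := by
  rw [Finset.sum_comm]
  simp only [sum_jointVS_left, ch.pS_sum]

theorem sum_jointVY_right (ch : StateChannel X S Y) (a : AuxChoice V X S) (v : V) :
    ∑ y, ch.jointVY a v y = ∑ s, ch.jointVS a v s := by
  simp only [jointVY]
  rw [Finset.sum_comm]
  simp only [← Finset.mul_sum, ch.W_sum, mul_one, jointVS]

/-- `I(V; S)` in nats as the mean of the logarithm of `p(v | s) / p(v)`. -/
theorem mutualInfoBits_jointVS_mul_log (ch : StateChannel X S Y) (a : AuxChoice V X S) :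
    mutualInfoBits (ch.jointVS a) * Real.log 2
      = ∑ v, ∑ s, ch.jointVS a v s * Real.log (a.p s v / ∑ s', ch.jointVS a v s') := by
  rw [mutualInfoBits_mul_log]
  refine Finset.sum_congr rfl fun v _ ↦ Finset.sum_congr rfl fun s _ ↦ ?_
  rw [sum_jointVS_left]
  by_cases h : ch.pS s = 0
  · simp [jointVS, h]
  · rw [jointVS, mul_comm (∑ s', ch.jointVS a v s'), mul_div_mul_left _ _ h]

theorem mutualInfoBits_jointVY_mul_log (ch : StateChannel X S Y) (a : AuxChoice V X S) :
    mutualInfoBits (ch.jointVY a) * Real.log 2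
      = ∑ v, ∑ y, ch.jointVY a v y *
          Real.log (ch.jointVY a v y / ((∑ s, ch.jointVS a v s) * ∑ v', ch.jointVY a v' y)) := by
  rw [mutualInfoBits_mul_log]
  simp only [sum_jointVY_right]

end StateChannel

namespace StateChannel

variable {V X S Y : Type} [Fintype V] [Fintype S] [Fintype Y]

/-- The joint typicality test of the decoder: the likelihood ratio of `(v, y)` against independence
is at least `exp g`. -/
def DecodingTest (ch : StateChannel X S Y) (a : AuxChoice V X S) (g : ℝ) {n : ℕ}
    (v : Fin n → V) (y : Fin n → Y) : Prop :=
  Real.exp g * ((∏ i, ∑ s, ch.jointVS a (v i) s) * ∏ i, ∑ v', ch.jointVY a v' (y i))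
      ≤ ∏ i, ch.jointVY a (v i) (y i) ∧
    0 < ∏ i, ∑ v', ch.jointVY a v' (y i)

open Classical in
/-- The compatibility relation of codewords and state vectors used by the encoder: the likelihood
ratio is at most `exp g`, the cost is at most `b`, and the decoding test fails with probability at
most `η`. -/
def Compatible (ch : StateChannel X S Y) (a : AuxChoice V X S) (g g' b η : ℝ) {n : ℕ}
    (v : Fin n → V) (s : Fin n → S) : Prop :=
  ∏ i, a.p (s i) (v i) ≤ Real.exp g * ∏ i, ∑ s', ch.jointVS a (v i) s' ∧
    ∑ i, ch.cost (a.x (v i) (s i)) ≤ b ∧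
    ∑ y : Fin n → Y, (∏ i, ch.W (a.x (v i) (s i)) (s i) (y i)) *
      (if ch.DecodingTest a g' v y then 0 else 1) ≤ η

open Classical in
theorem sum_decodingTest_le (ch : StateChannel X S Y) (a : AuxChoice V X S) (g : ℝ) {n : ℕ}
    (y : Fin n → Y) :
    ∑ v : Fin n → V, (∏ i, ∑ s, ch.jointVS a (v i) s) *
      (if ch.DecodingTest a g v y then 1 else 0) ≤ Real.exp (-g) := by
  by_cases hy : 0 < ∏ i, ∑ v', ch.jointVY a v' (y i)
  · refine le_of_mul_le_mul_right ?_ hy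
    rw [Finset.sum_mul]
    have h : ∀ v : Fin n → V, (∏ i, ∑ s, ch.jointVS a (v i) s) *
        (if ch.DecodingTest a g v y then 1 else 0) * ∏ i, ∑ v', ch.jointVY a v' (y i)
        ≤ Real.exp (-g) * ∏ i, ch.jointVY a (v i) (y i) := by
      intro v
      split_ifs with hT
      · rw [mul_one, Real.exp_neg, ← div_eq_inv_mul, le_div_iff₀' (Real.exp_pos g)]
        exact hT.1
      · rw [mul_zero, zero_mul]
        exact mul_nonneg (Real.exp_pos _).le
          (Finset.prod_nonneg fun i _ ↦ ch.jointVY_nonneg a _ _)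
    refine (Finset.sum_le_sum fun v _ ↦ h v).trans ?_
    rw [← Finset.mul_sum, sum_pi_prod (fun i v ↦ ch.jointVY a v (y i))]
  · simp [DecodingTest, hy, (Real.exp_pos _).le]

open Classical in
/-- Under the joint distribution of `(V, S, Y)` the decoding test at a level below `I(V; Y)` fails
with small probability. -/
theorem sum_not_decodingTest_le (ch : StateChannel X S Y) (a : AuxChoice V X S) {d η : ℝ}
    (hd : 0 < d) (hη : 0 < η) :
    ∃ N : ℕ, ∀ n : ℕ, N ≤ n → ∑ v : Fin n → V, ∑ s : Fin n → S, ∑ y : Fin n → Y,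
      (∏ i, ch.jointVS a (v i) (s i)) * (∏ i, ch.W (a.x (v i) (s i)) (s i) (y i)) *
        (if ch.DecodingTest a (n * (mutualInfoBits (ch.jointVY a) * Real.log 2 - d)) v y
          then 0 else 1) ≤ η := by
  let p : V × S × Y → ℝ := fun z ↦ ch.jointVS a z.1 z.2.1 * ch.W (a.x z.1 z.2.1) z.2.1 z.2.2
  let f : V × S × Y → ℝ := fun z ↦ Real.log (ch.jointVY a z.1 z.2.2 /
    ((∑ s, ch.jointVS a z.1 s) * ∑ v', ch.jointVY a v' z.2.2))
  have hp0 : ∀ z, 0 ≤ p z := fun z ↦ mul_nonneg (ch.jointVS_nonneg a _ _) (ch.W_nonneg _ _ _)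
  have hp : ∑ z, p z = 1 := by
    simp only [p, Fintype.sum_prod_type, ← Finset.mul_sum, ch.W_sum, mul_one, sum_jointVS]
  have hmean : ∑ z, p z * f z = mutualInfoBits (ch.jointVY a) * Real.log 2 := by
    rw [mutualInfoBits_jointVY_mul_log]
    simp only [p, f, Fintype.sum_prod_type]
    refine Finset.sum_congr rfl fun v _ ↦ ?_
    rw [Finset.sum_comm]
    refine Finset.sum_congr rfl fun y _ ↦ ?_
    rw [← Finset.sum_mul]
    rfl
  obtain ⟨N, hN⟩ := weak_law hp0 hp f hd hη
  refine ⟨N, fun n hn ↦ le_trans ?_ (hN n hn)⟩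
  rw [sum_pi_prod_type]
  refine Finset.sum_le_sum fun v _ ↦ ?_
  rw [sum_pi_prod_type]
  refine Finset.sum_le_sum fun s _ ↦ Finset.sum_le_sum fun y _ ↦ ?_
  rw [hmean]
  simp only [p, f, Finset.prod_mul_distrib]
  set I := mutualInfoBits (ch.jointVY a) * Real.log 2
  have hJ : 0 ≤ ∏ i, ch.jointVS a (v i) (s i) :=
    Finset.prod_nonneg fun i _ ↦ ch.jointVS_nonneg a _ _
  have hWn : 0 ≤ ∏ i, ch.W (a.x (v i) (s i)) (s i) (y i) :=
    Finset.prod_nonneg fun i _ ↦ ch.W_nonneg _ _ _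
  rcases (mul_nonneg hJ hWn).eq_or_lt with h0 | h0
  · rw [← h0, zero_mul, zero_mul]
  refine mul_le_mul_of_nonneg_left ?_ h0.le
  by_cases hT : ch.DecodingTest a (n * (I - d)) v y
  · rw [if_pos hT]; split_ifs <;> norm_num
  rw [if_neg hT, if_pos]
  have hJp := pos_of_prod_ne_zero (fun i ↦ ch.jointVS_nonneg a _ _) (left_ne_zero_of_mul h0.ne')
  have hWp := pos_of_prod_ne_zero (fun i ↦ ch.W_nonneg _ _ _) (right_ne_zero_of_mul h0.ne')
  have h1 : ∀ i, 0 < ch.jointVY a (v i) (y i) := fun i ↦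
    (mul_pos (hJp i) (hWp i)).trans_le (Finset.single_le_sum
      (f := fun s ↦ ch.jointVS a (v i) s * ch.W (a.x (v i) s) s (y i))
      (fun s _ ↦ mul_nonneg (ch.jointVS_nonneg a _ _) (ch.W_nonneg _ _ _)) (Finset.mem_univ (s i)))
  have h2 : ∀ i, 0 < ∑ s, ch.jointVS a (v i) s := fun i ↦
    (hJp i).trans_le (Finset.single_le_sum (f := fun s ↦ ch.jointVS a (v i) s)
      (fun s _ ↦ ch.jointVS_nonneg a _ _) (Finset.mem_univ (s i)))
  have h3 : ∀ i, 0 < ∑ v', ch.jointVY a v' (y i) := fun i ↦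
    (h1 i).trans_le (Finset.single_le_sum (f := fun v' ↦ ch.jointVY a v' (y i))
      (fun v' _ ↦ ch.jointVY_nonneg a _ _) (Finset.mem_univ (v i)))
  have h4 := prod_eq_exp_sum_log_mul_prod h1 (fun i ↦ mul_pos (h2 i) (h3 i))
  rw [Finset.prod_mul_distrib] at h4
  set L := ∑ i, Real.log (ch.jointVY a (v i) (y i) /
    ((∑ s, ch.jointVS a (v i) s) * ∑ v', ch.jointVY a v' (y i)))
  have h5 : L < n * (I - d) := by
    by_contra! hle
    refine hT ⟨?_, Finset.prod_pos fun i _ ↦ h3 i⟩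
    rw [h4]
    exact mul_le_mul_of_nonneg_right (Real.exp_le_exp.2 hle)
      (mul_pos (Finset.prod_pos fun i _ ↦ h2 i) (Finset.prod_pos fun i _ ↦ h3 i)).le
  rw [le_abs]
  right
  linarith

open Classical in
/-- Under the joint distribution of `(V, S)` a codeword and a state vector are compatible with high
probability. -/
theorem sum_not_compatible_le (ch : StateChannel X S Y) (a : AuxChoice V X S) {B d η : ℝ}
    (hB : ch.auxCost a < B) (hd : 0 < d) (hη : 0 < η) :
    ∃ N : ℕ, ∀ n : ℕ, N ≤ n → ∑ v : Fin n → V, ∑ s : Fin n → S,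
      (∏ i, ch.pS (s i)) * (∏ i, a.p (s i) (v i)) *
        (if ch.Compatible a (n * (mutualInfoBits (ch.jointVS a) * Real.log 2 + d))
          (n * (mutualInfoBits (ch.jointVY a) * Real.log 2 - d)) (n * B) η v s
          then 0 else 1) ≤ 3 * η := by
  let p : V × S → ℝ := fun z ↦ ch.jointVS a z.1 z.2
  let f : V × S → ℝ := fun z ↦ Real.log (a.p z.2 z.1 / ∑ s, ch.jointVS a z.1 s)
  let c : V × S → ℝ := fun z ↦ ch.cost (a.x z.1 z.2)
  have hp0 : ∀ z, 0 ≤ p z := fun z ↦ ch.jointVS_nonneg a _ _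
  have hp : ∑ z, p z = 1 := by simp only [p, Fintype.sum_prod_type, sum_jointVS]
  have hmean : ∑ z, p z * f z = mutualInfoBits (ch.jointVS a) * Real.log 2 := by
    rw [mutualInfoBits_jointVS_mul_log]
    simp only [p, f, Fintype.sum_prod_type]
  have hcmean : ∑ z, p z * c z = ch.auxCost a := by
    simp only [p, c, Fintype.sum_prod_type]
    rw [Finset.sum_comm]
    rfl
  obtain ⟨N₁, hN₁⟩ := weak_law hp0 hp f hd hη
  obtain ⟨N₂, hN₂⟩ := weak_law hp0 hp c (sub_pos.2 hB) hη
  obtain ⟨N₃, hN₃⟩ := ch.sum_not_decodingTest_le a hd (mul_pos hη hη)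
  refine ⟨max N₁ (max N₂ N₃), fun n hn ↦ ?_⟩
  have k₁ := hN₁ n (by omega)
  have k₂ := hN₂ n (by omega)
  have k₃ := hN₃ n (by omega)
  rw [hmean, sum_pi_prod_type] at k₁
  rw [hcmean, sum_pi_prod_type] at k₂
  simp only [p, f, c] at k₁ k₂
  set I := mutualInfoBits (ch.jointVS a) * Real.log 2
  set g' := n * (mutualInfoBits (ch.jointVY a) * Real.log 2 - d)
  have hpt : ∀ (v : Fin n → V) (s : Fin n → S),
      (∏ i, ch.pS (s i)) * (∏ i, a.p (s i) (v i)) *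
        (if ch.Compatible a (n * (I + d)) g' (n * B) η v s then 0 else 1)
      ≤ (∏ i, ch.jointVS a (v i) (s i)) * (if n * d ≤ |∑ i, Real.log (a.p (s i) (v i) /
          ∑ s', ch.jointVS a (v i) s') - n * I| then 1 else 0)
        + (∏ i, ch.jointVS a (v i) (s i)) * (if n * (B - ch.auxCost a) ≤
          |∑ i, ch.cost (a.x (v i) (s i)) - n * ch.auxCost a| then 1 else 0)
        + (∑ y : Fin n → Y, (∏ i, ch.jointVS a (v i) (s i)) *
          (∏ i, ch.W (a.x (v i) (s i)) (s i) (y i)) *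
          (if ch.DecodingTest a g' v y then 0 else 1)) / η := by
    intro v s
    have hprod : (∏ i, ch.pS (s i)) * (∏ i, a.p (s i) (v i))
        = ∏ i, ch.jointVS a (v i) (s i) := by
      rw [← Finset.prod_mul_distrib]; rfl
    simp only [mul_assoc (∏ i, ch.jointVS a (v i) (s i))]
    rw [hprod, ← Finset.mul_sum, mul_div_assoc, ← mul_add, ← mul_add]
    set w := ∑ y : Fin n → Y, (∏ i, ch.W (a.x (v i) (s i)) (s i) (y i)) *
      (if ch.DecodingTest a g' v y then 0 else 1) with hw
    have hw0 : 0 ≤ w := Finset.sum_nonneg fun y _ ↦ mul_nonneg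
      (Finset.prod_nonneg fun i _ ↦ ch.W_nonneg _ _ _) (by split_ifs <;> norm_num)
    have hwη : 0 ≤ w / η := div_nonneg hw0 hη.le
    have hJ : 0 ≤ ∏ i, ch.jointVS a (v i) (s i) :=
      Finset.prod_nonneg fun i _ ↦ ch.jointVS_nonneg a _ _
    rcases hJ.eq_or_lt with h0 | h0
    · rw [← h0, zero_mul, zero_mul]
    refine mul_le_mul_of_nonneg_left ?_ hJ
    by_cases hA : ch.Compatible a (n * (I + d)) g' (n * B) η v s
    · rw [if_pos hA]
      refine add_nonneg (add_nonneg ?_ ?_) hwη <;> split_ifs <;> norm_num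
    rw [if_neg hA]
    have hJp := pos_of_prod_ne_zero (fun i ↦ ch.jointVS_nonneg a _ _) h0.ne'
    have h1 : ∀ i, 0 < a.p (s i) (v i) := fun i ↦
      (a.p_nonneg _ _).lt_of_ne' (right_ne_zero_of_mul (hJp i).ne')
    have h2 : ∀ i, 0 < ∑ s, ch.jointVS a (v i) s := fun i ↦
      (hJp i).trans_le (Finset.single_le_sum (f := fun s ↦ ch.jointVS a (v i) s)
        (fun s _ ↦ ch.jointVS_nonneg a _ _) (Finset.mem_univ (s i)))
    have h4 := prod_eq_exp_sum_log_mul_prod h1 h2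
    set L := ∑ i, Real.log (a.p (s i) (v i) / ∑ s', ch.jointVS a (v i) s')
    by_cases hf : n * (I + d) < L
    · have : n * d ≤ |L - n * I| := by
        rw [le_abs]; left; linarith
      rw [if_pos this]
      have : (0 : ℝ) ≤ if n * (B - ch.auxCost a) ≤
        |∑ i, ch.cost (a.x (v i) (s i)) - n * ch.auxCost a| then 1 else 0 := by
        split_ifs <;> norm_num
      linarith
    have hnn : (0 : ℝ) ≤ if n * d ≤ |L - n * I| then 1 else 0 := by split_ifs <;> norm_num
    by_cases hc : n * B < ∑ i, ch.cost (a.x (v i) (s i))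
    · have : n * (B - ch.auxCost a) ≤ |∑ i, ch.cost (a.x (v i) (s i)) - n * ch.auxCost a| := by
        rw [le_abs]; left; linarith
      rw [if_pos this]
      linarith
    have hnn' : (0 : ℝ) ≤ if n * (B - ch.auxCost a) ≤
        |∑ i, ch.cost (a.x (v i) (s i)) - n * ch.auxCost a| then 1 else 0 := by
      split_ifs <;> norm_num
    have hwgt : η < w := by
      by_contra! hle
      refine hA ⟨?_, not_lt.1 hc, hle⟩
      rw [h4]
      exact mul_le_mul_of_nonneg_right (Real.exp_le_exp.2 (not_lt.1 hf))
        (Finset.prod_pos fun i _ ↦ h2 i).le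
    have := (one_le_div hη).2 hwgt.le
    linarith
  refine (Finset.sum_le_sum fun v _ ↦ Finset.sum_le_sum fun s _ ↦ hpt v s).trans ?_
  simp only [Finset.sum_add_distrib, ← Finset.sum_div]
  have : (∑ v : Fin n → V, ∑ s : Fin n → S, ∑ y : Fin n → Y,
      (∏ i, ch.jointVS a (v i) (s i)) * (∏ i, ch.W (a.x (v i) (s i)) (s i) (y i)) *
        (if ch.DecodingTest a g' v y then 0 else 1)) / η ≤ η := by
    rwa [div_le_iff₀ hη]
  linarith

/-- The Gelfand-Pinsker coding theorem with a cost constraint: every rate `R ≥ 0` below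
`I(V; Y) - I(V; S)` is achievable. -/
theorem achievable_of_lt_gpRate (ch : StateChannel X S Y) (a : AuxChoice V X S) {B R : ℝ}
    {x₀ : X} (hx₀ : ch.cost x₀ ≤ B) (hB : ch.auxCost a < B) (hR0 : 0 ≤ R) (hR : R < ch.gpRate a) :
    ch.Achievable B R := by
  classical
  intro δ hδ
  have hlog : 0 < Real.log 2 := Real.log_pos one_lt_two
  set IY := mutualInfoBits (ch.jointVY a) * Real.log 2 with hIY
  set IS := mutualInfoBits (ch.jointVS a) * Real.log 2 with hIS
  have hIS0 : 0 ≤ IS :=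
    mul_nonneg (mutualInfoBits_nonneg (ch.jointVS_nonneg a) (ch.sum_jointVS a)) hlog.le
  have hgap : 0 < IY - IS - R * Real.log 2 := by
    have := mul_lt_mul_of_pos_right hR hlog
    rw [gpRate, sub_mul] at this
    linarith
  obtain ⟨d, hd⟩ : ∃ d, d = (IY - IS - R * Real.log 2) / 4 := ⟨_, rfl⟩
  have hd0 : 0 < d := by rw [hd]; positivity
  have hη : 0 < δ / 8 := by positivity
  obtain ⟨N₁, hN₁⟩ := ch.sum_not_compatible_le a hB hd0 hη
  obtain ⟨N₂, hN₂⟩ := exists_nat_ge (10 / (d * δ))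
  refine ⟨max N₁ (N₂ + 1), fun n hn ↦ ?_⟩
  have k := hN₁ n (by omega)
  have hn0 : (0 : ℝ) < n := by
    have : 0 < n := by omega
    exact_mod_cast this
  have hnd : 10 ≤ n * d * δ := by
    have : 10 / (d * δ) ≤ n := hN₂.trans (by exact_mod_cast (by omega : N₂ ≤ n))
    rw [div_le_iff₀ (by positivity)] at this
    linarith
  have hexp : Real.exp (-(n * d)) ≤ δ / 10 := by
    rw [Real.exp_neg, inv_le_comm₀ (Real.exp_pos _) (by positivity), inv_div,
      div_le_iff₀ hδ]
    nlinarith [Real.add_one_le_exp (n * d)]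
  rw [← hIS, ← hIY] at k
  set M : ℕ := ⌈(2 : ℝ) ^ ((n : ℝ) * R)⌉₊ with hM
  set K : ℕ := ⌈Real.exp (n * (IS + 2 * d))⌉₊ with hK
  have hM1 : (2 : ℝ) ^ ((n : ℝ) * R) ≤ M := Nat.le_ceil _
  have h2pos : (0 : ℝ) < (2 : ℝ) ^ ((n : ℝ) * R) := by positivity
  have hMpos : 0 < M := Nat.ceil_pos.2 h2pos
  have hM2 : (M : ℝ) ≤ 2 * Real.exp (n * (R * Real.log 2)) := by
    have h1 := (Nat.ceil_lt_add_one h2pos.le).le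
    have h2 : (1 : ℝ) ≤ (2 : ℝ) ^ ((n : ℝ) * R) :=
      Real.one_le_rpow one_le_two (by positivity)
    have h3 : (2 : ℝ) ^ ((n : ℝ) * R) = Real.exp (n * (R * Real.log 2)) := by
      rw [Real.rpow_def_of_pos two_pos]; ring_nf
    rw [← h3]
    linarith
  have hK1 : Real.exp (n * (IS + 2 * d)) ≤ K := Nat.le_ceil _
  have hK2 : (K : ℝ) ≤ 2 * Real.exp (n * (IS + 2 * d)) := by
    have h1 := (Nat.ceil_lt_add_one (Real.exp_pos (n * (IS + 2 * d))).le).le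
    have h2 : (1 : ℝ) ≤ Real.exp (n * (IS + 2 * d)) := Real.one_le_exp (by positivity)
    linarith
  obtain ⟨enc, dec, henc, herr⟩ := exists_binning_code
    (Q := fun v : Fin n → V ↦ ∏ i, ∑ s, ch.jointVS a (v i) s)
    (P := fun s : Fin n → S ↦ ∏ i, ch.pS (s i))
    (W := fun (x : Fin n → X) (s : Fin n → S) (y : Fin n → Y) ↦ ∏ i, ch.W (x i) (s i) (y i))
    (fun v ↦ Finset.prod_nonneg fun i _ ↦ Finset.sum_nonneg fun s _ ↦ ch.jointVS_nonneg a _ _)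
    (sum_pi_prod_eq_one fun _ ↦ ch.sum_jointVS a)
    (fun s ↦ Finset.prod_nonneg fun i _ ↦ ch.pS_nonneg _)
    (sum_pi_prod_eq_one fun _ ↦ ch.pS_sum)
    (fun x s y ↦ Finset.prod_nonneg fun i _ ↦ ch.W_nonneg _ _ _)
    (fun x s ↦ sum_pi_prod_eq_one fun i ↦ ch.W_sum (x i) (s i))
    (fun v s i ↦ a.x (v i) (s i)) (fun _ ↦ x₀)
    (fun v s ↦ ch.Compatible a (n * (IS + d)) (n * (IY - d)) (n * B) (δ / 8) v s)
    (fun v y ↦ ch.DecodingTest a (n * (IY - d)) v y) hη.le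
    (fun v s h ↦ h.2.2) (fun y ↦ ch.sum_decodingTest_le a _ y) hMpos K
  have hcover := sum_mul_one_sub_pow_le
    (Q := fun v : Fin n → V ↦ ∏ i, ∑ s, ch.jointVS a (v i) s)
    (P := fun s : Fin n → S ↦ ∏ i, ch.pS (s i))
    (p := fun (s : Fin n → S) (v : Fin n → V) ↦ ∏ i, a.p (s i) (v i))
    (fun v ↦ Finset.prod_nonneg fun i _ ↦ Finset.sum_nonneg fun s _ ↦ ch.jointVS_nonneg a _ _)
    (sum_pi_prod_eq_one fun _ ↦ ch.sum_jointVS a)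
    (fun s ↦ Finset.prod_nonneg fun i _ ↦ ch.pS_nonneg _)
    (sum_pi_prod_eq_one fun _ ↦ ch.pS_sum)
    (fun s v ↦ Finset.prod_nonneg fun i _ ↦ a.p_nonneg _ _)
    (fun s ↦ sum_pi_prod_eq_one fun i ↦ a.p_sum (s i))
    (A := fun v s ↦ ch.Compatible a (n * (IS + d)) (n * (IY - d)) (n * B) (δ / 8) v s)
    (Real.exp_pos (n * (IS + d))) (fun v s h ↦ h.1) K
  have hM0 : (0 : ℝ) < M := by exact_mod_cast hMpos
  have hcost : ∀ m s, ∑ i, ch.cost (enc m s i) ≤ n * B := by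
    intro m s
    rcases henc m s with h | ⟨v, hv, h⟩
    · rw [h]
      simpa using mul_le_mul_of_nonneg_left hx₀ hn0.le
    · rw [h]; exact hv.2.1
  refine ⟨M, ⟨enc, dec⟩, hM1, ?_, ?_⟩
  · have hle : ∑ m : Fin M, ∑ s : Fin n → S, (∏ j, ch.pS (s j)) * ∑ i, ch.cost (enc m s i)
        ≤ M * (n * B) := by
      have hs : ∀ m : Fin M, ∑ s : Fin n → S, (∏ j, ch.pS (s j)) * ∑ i, ch.cost (enc m s i)
          ≤ n * B := by
        intro m
        refine (Finset.sum_le_sum fun s _ ↦ mul_le_mul_of_nonneg_left (hcost m s)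
          (Finset.prod_nonneg fun i _ ↦ ch.pS_nonneg _)).trans (le_of_eq ?_)
        rw [← Finset.sum_mul, sum_pi_prod_eq_one (fun _ ↦ ch.pS_sum), one_mul]
      refine (Finset.sum_le_sum fun m _ ↦ hs m).trans (le_of_eq ?_)
      simp
    rw [expectedCost, ← Finset.sum_div, div_le_iff₀ hM0, mul_comm _ (M : ℝ)]
    refine le_trans (le_of_eq ?_) hle
    rw [Finset.sum_comm]
    refine Finset.sum_congr rfl fun m _ ↦ ?_
    rw [Finset.sum_comm]
    simp only [Finset.mul_sum]
  · rw [errorProb, div_le_iff₀ hM0, mul_comm δ]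
    refine herr.trans (mul_le_mul_of_nonneg_left ?_ hM0.le)
    have hL : n * d ≤ K / Real.exp (n * (IS + d)) := by
      rw [le_div_iff₀ (Real.exp_pos _)]
      refine le_trans ?_ hK1
      rw [show (n : ℝ) * (IS + 2 * d) = n * d + n * (IS + d) by ring, Real.exp_add]
      exact mul_le_mul_of_nonneg_right (by linarith [Real.add_one_le_exp (n * d)])
        (Real.exp_pos _).le
    have hL2 : Real.exp (-(K / Real.exp (n * (IS + d)))) ≤ δ / 10 :=
      (Real.exp_le_exp.2 (neg_le_neg hL)).trans hexp
    have hpack : (M : ℝ) * (K * Real.exp (-(n * (IY - d)))) ≤ 4 * (δ / 10) := by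
      calc (M : ℝ) * (K * Real.exp (-(n * (IY - d))))
          ≤ 2 * Real.exp (n * (R * Real.log 2)) *
            (2 * Real.exp (n * (IS + 2 * d)) * Real.exp (-(n * (IY - d)))) := by gcongr
        _ = 4 * Real.exp (-(n * d)) := by
            have : -(n * d) = n * (R * Real.log 2) + (n * (IS + 2 * d) + -(n * (IY - d))) := by
              rw [hd]; ring
            rw [this, Real.exp_add, Real.exp_add]; ring
        _ ≤ _ := by linarith
    linarith

/-- The rate zero and all negative rates are achievable by codes with one message. -/
theorem achievable_of_nonpos (ch : StateChannel X S Y) {B R : ℝ} {x₀ : X} (hx₀ : ch.cost x₀ ≤ B)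
    (hR : R ≤ 0) : ch.Achievable B R := by
  refine fun δ hδ ↦ ⟨0, fun n _ ↦ ⟨1, ⟨fun _ _ _ ↦ x₀, fun _ ↦ 0⟩, ?_, ?_, ?_⟩⟩
  · rw [Nat.cast_one]
    exact Real.rpow_le_one_of_one_le_of_nonpos one_le_two
      (mul_nonpos_of_nonneg_of_nonpos n.cast_nonneg hR)
  · simp only [expectedCost, ← Finset.sum_mul, sum_pi_prod_eq_one (fun _ ↦ ch.pS_sum)]
    simpa using mul_le_mul_of_nonneg_left hx₀ n.cast_nonneg
  · simp [errorProb, hδ.le]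

end StateChannel

/-- A change of measure bound: the probability of an event `D` under a product pmf is bounded by its
probability under another one and the relative entropy. -/
theorem log_mul_sum_sub_le_sum_relEntropy {ι Y : Type} [Fintype ι] [DecidableEq ι] [Fintype Y]
    {w q : ι → Y → ℝ} (hw0 : ∀ i y, 0 ≤ w i y) (hw : ∀ i, ∑ y, w i y = 1)
    (hq0 : ∀ i y, 0 ≤ q i y) (hq : ∀ i, ∑ y, q i y = 1) (hwq : ∀ i y, q i y = 0 → w i y = 0)
    (D : (ι → Y) → Prop) [DecidablePred D] {M : ℝ} (hM : 0 < M) :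
    Real.log M * ∑ y : ι → Y, (∏ i, w i (y i)) * (if D y then 1 else 0)
        - M * ∑ y : ι → Y, (∏ i, q i (y i)) * (if D y then 1 else 0)
      ≤ ∑ i, ∑ y, w i y * Real.log (w i y / q i y) := by
  have hD : ∑ i, ∑ y, w i y * Real.log (w i y / q i y)
      = ∑ y : ι → Y, (∏ i, w i (y i)) * ∑ i, Real.log (w i (y i) / q i (y i)) := by
    symm
    simp only [Finset.mul_sum]
    rw [Finset.sum_comm]
    exact Finset.sum_congr rfl fun i _ ↦
      sum_pi_prod_mul hw i (fun y ↦ Real.log (w i y / q i y))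
  have hpt : ∀ y : ι → Y, Real.log M * ((∏ i, w i (y i)) * (if D y then 1 else 0))
        + ∏ i, w i (y i) - ∏ i, q i (y i) - M * ((∏ i, q i (y i)) * (if D y then 1 else 0))
      ≤ (∏ i, w i (y i)) * ∑ i, Real.log (w i (y i) / q i (y i)) := by
    intro y
    have hQ : 0 ≤ ∏ i, q i (y i) := Finset.prod_nonneg fun i _ ↦ hq0 _ _
    have hP : 0 ≤ ∏ i, w i (y i) := Finset.prod_nonneg fun i _ ↦ hw0 _ _
    rcases hP.eq_or_lt with h0 | h0
    · rw [← h0]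
      have : 0 ≤ M * ((∏ i, q i (y i)) * (if D y then 1 else 0)) :=
        mul_nonneg hM.le (mul_nonneg hQ (by split_ifs <;> norm_num))
      simp only [zero_mul, mul_zero]
      linarith
    have hw' := pos_of_prod_ne_zero (fun i ↦ hw0 i (y i)) h0.ne'
    have hq' : ∀ i, 0 < q i (y i) := fun i ↦
      (hq0 i (y i)).lt_of_ne' fun h ↦ (hw' i).ne' (hwq i _ h)
    have h1 := prod_eq_exp_sum_log_mul_prod hw' hq'
    set L := ∑ i, Real.log (w i (y i) / q i (y i))
    set P := ∏ i, w i (y i)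
    set Q := ∏ i, q i (y i)
    have hQP : Q = P * Real.exp (-L) := by
      rw [h1, Real.exp_neg]
      field_simp
    split_ifs
    · have h2 : M * Q = P * Real.exp (Real.log M - L) := by
        rw [hQP, sub_eq_add_neg, Real.exp_add, Real.exp_log hM]; ring
      have h3 := mul_le_mul_of_nonneg_left (Real.add_one_le_exp (Real.log M - L)) h0.le
      rw [← h2] at h3
      nlinarith
    · have h3 := mul_le_mul_of_nonneg_left (Real.add_one_le_exp (-L)) h0.le
      rw [← hQP] at h3
      nlinarith
  rw [hD]
  refine le_trans (le_of_eq ?_) (Finset.sum_le_sum fun y _ ↦ hpt y)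
  simp only [Finset.sum_sub_distrib, Finset.sum_add_distrib, ← Finset.mul_sum,
    sum_pi_prod_eq_one hw, sum_pi_prod_eq_one hq]
  ring

namespace StateChannel

variable {X S Y : Type} [Fintype S] [Fintype Y]

/-- A Fano-type bound for codes with informed encoder, where the relative entropies of the channel
outputs to a reference channel `q` from the state are bounded affinely in the cost. -/
theorem one_sub_errorProb_mul_log_le (ch : StateChannel X S Y) {q : S → Y → ℝ}
    (hq0 : ∀ s y, 0 ≤ q s y) (hq : ∀ s, ∑ y, q s y = 1)
    (hac : ∀ x s y, q s y = 0 → ch.W x s y = 0) {κ : S → ℝ} {l : ℝ}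
    (hd : ∀ x s, ∑ y, ch.W x s y * Real.log (ch.W x s y / q s y) ≤ κ s + l * ch.cost x)
    {n M : ℕ} (hM : 0 < M) (c : StateCode X S Y n M) :
    (1 - ch.errorProb c) * Real.log M - 1
      ≤ n * ∑ s, ch.pS s * κ s + l * ch.expectedCost c := by
  have hM0 : (0 : ℝ) < M := by exact_mod_cast hM
  have hP : ∑ s : Fin n → S, ∏ i, ch.pS (s i) = 1 := sum_pi_prod_eq_one fun _ ↦ ch.pS_sum
  have hP0 : ∀ s : Fin n → S, 0 ≤ ∏ i, ch.pS (s i) := fun s ↦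
    Finset.prod_nonneg fun i _ ↦ ch.pS_nonneg _
  have hcore : ∀ (m : Fin M) (s : Fin n → S),
      Real.log M * (1 - ∑ y : Fin n → Y, (∏ i, ch.W (c.enc m s i) (s i) (y i)) *
          (if c.dec y = m then 0 else 1))
        - M * ∑ y : Fin n → Y, (∏ i, q (s i) (y i)) * (if c.dec y = m then 1 else 0)
      ≤ ∑ i, κ (s i) + l * ∑ i, ch.cost (c.enc m s i) := by
    intro m s
    have h := log_mul_sum_sub_le_sum_relEntropy (w := fun i ↦ ch.W (c.enc m s i) (s i))
      (q := fun i ↦ q (s i)) (fun i y ↦ ch.W_nonneg _ _ _) (fun i ↦ ch.W_sum _ _)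
      (fun i y ↦ hq0 _ _) (fun i ↦ hq _) (fun i y ↦ hac _ _ _) (fun y ↦ c.dec y = m) hM0
    have h2 : ∑ y : Fin n → Y, (∏ i, ch.W (c.enc m s i) (s i) (y i)) *
          (if c.dec y = m then 1 else 0)
        = 1 - ∑ y : Fin n → Y, (∏ i, ch.W (c.enc m s i) (s i) (y i)) *
          (if c.dec y = m then 0 else 1) := by
      rw [eq_sub_iff_add_eq, ← Finset.sum_add_distrib]
      exact (Finset.sum_congr rfl fun y _ ↦ by split_ifs <;> ring).trans
        (sum_pi_prod_eq_one (fun i ↦ ch.W_sum (c.enc m s i) (s i)))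
    have h3 : ∑ i, ∑ y, ch.W (c.enc m s i) (s i) y *
          Real.log (ch.W (c.enc m s i) (s i) y / q (s i) y)
        ≤ ∑ i, κ (s i) + l * ∑ i, ch.cost (c.enc m s i) := by
      rw [Finset.mul_sum, ← Finset.sum_add_distrib]
      exact Finset.sum_le_sum fun i _ ↦ hd _ _
    rw [← h2]
    exact h.trans h3
  have hsum := Finset.sum_le_sum fun (m : Fin M) (_ : m ∈ Finset.univ) ↦
    Finset.sum_le_sum fun (s : Fin n → S) (_ : s ∈ Finset.univ) ↦
      mul_le_mul_of_nonneg_left (hcore m s) (hP0 s)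
  have hE : ∑ m : Fin M, ∑ s : Fin n → S, (∏ i, ch.pS (s i)) *
      ∑ y : Fin n → Y, (∏ i, ch.W (c.enc m s i) (s i) (y i)) * (if c.dec y = m then 0 else 1)
      = M * ch.errorProb c := by
    rw [errorProb, mul_div_cancel₀ _ hM0.ne']
    simp only [Finset.mul_sum, mul_assoc]
  have hG : ∑ m : Fin M, ∑ s : Fin n → S, (∏ i, ch.pS (s i)) *
      ∑ y : Fin n → Y, (∏ i, q (s i) (y i)) * (if c.dec y = m then 1 else 0) = 1 := by
    rw [Finset.sum_comm]
    refine (Finset.sum_congr rfl fun s _ ↦ ?_).trans hP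
    rw [← Finset.mul_sum, Finset.sum_comm]
    simp only [← Finset.mul_sum]
    simp only [Finset.sum_ite_eq, Finset.mem_univ, if_true, mul_one]
    rw [sum_pi_prod_eq_one (fun i ↦ hq (s i)), mul_one]
  have hK : ∑ s : Fin n → S, (∏ i, ch.pS (s i)) * ∑ i, κ (s i) = n * ∑ s, ch.pS s * κ s := by
    simp only [Finset.mul_sum]
    rw [Finset.sum_comm]
    simp only [sum_pi_prod_mul (p := fun _ : Fin n ↦ ch.pS) (fun _ ↦ ch.pS_sum) _ κ]
    rw [Finset.sum_const, Finset.card_univ, Fintype.card_fin, nsmul_eq_mul, Finset.mul_sum]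
  have hC : ∑ m : Fin M, ∑ s : Fin n → S, (∏ i, ch.pS (s i)) * ∑ i, ch.cost (c.enc m s i)
      = M * ch.expectedCost c := by
    rw [expectedCost, ← Finset.sum_div, mul_div_cancel₀ _ hM0.ne',
      Finset.sum_comm (s := (Finset.univ : Finset (Fin n)))]
    refine Finset.sum_congr rfl fun m _ ↦ ?_
    rw [Finset.sum_comm]
    simp only [Finset.mul_sum]
  have hl : ∑ m : Fin M, ∑ s : Fin n → S, (∏ i, ch.pS (s i)) *
      (Real.log M * (1 - ∑ y : Fin n → Y, (∏ i, ch.W (c.enc m s i) (s i) (y i)) *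
          (if c.dec y = m then 0 else 1))
        - M * ∑ y : Fin n → Y, (∏ i, q (s i) (y i)) * (if c.dec y = m then 1 else 0))
      = Real.log M * (M - M * ch.errorProb c) - M * 1 := by
    have hlin : ∀ e g : Fin M → (Fin n → S) → ℝ, ∑ m, ∑ s, (∏ i, ch.pS (s i)) *
        (Real.log M * (1 - e m s) - M * g m s)
        = Real.log M * (M - ∑ m, ∑ s, (∏ i, ch.pS (s i)) * e m s)
          - M * ∑ m, ∑ s, (∏ i, ch.pS (s i)) * g m s := by
      intro e g
      simp only [mul_sub, mul_one, Finset.sum_sub_distrib, mul_left_comm _ (Real.log M),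
        mul_left_comm _ (M : ℝ), ← Finset.mul_sum, ← Finset.sum_mul, hP]
      rw [Finset.sum_const, Finset.card_univ, Fintype.card_fin, nsmul_eq_mul]
      ring
    exact (hlin _ _).trans (by rw [hE, hG])
  have hr : ∑ m : Fin M, ∑ s : Fin n → S, (∏ i, ch.pS (s i)) *
      (∑ i, κ (s i) + l * ∑ i, ch.cost (c.enc m s i))
      = M * (n * ∑ s, ch.pS s * κ s) + l * (M * ch.expectedCost c) := by
    rw [← hC]
    simp only [mul_add, Finset.sum_add_distrib, mul_left_comm _ l, ← Finset.mul_sum, hK]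
    rw [Finset.sum_const, Finset.card_univ, Fintype.card_fin, nsmul_eq_mul]
    ring
  rw [hl, hr] at hsum
  refine le_of_mul_le_mul_left ?_ hM0
  linarith

/-- The converse: an upper bound of all achievable rates from a reference channel `q`. -/
theorem Achievable.mul_log_le {ch : StateChannel X S Y} {q : S → Y → ℝ}
    (hq0 : ∀ s y, 0 ≤ q s y) (hq : ∀ s, ∑ y, q s y = 1)
    (hac : ∀ x s y, q s y = 0 → ch.W x s y = 0) {κ : S → ℝ} {l : ℝ} (hl : 0 ≤ l)
    (hd : ∀ x s, ∑ y, ch.W x s y * Real.log (ch.W x s y / q s y) ≤ κ s + l * ch.cost x)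
    {B R : ℝ} (h : ch.Achievable B R) : R * Real.log 2 ≤ ∑ s, ch.pS s * κ s + l * B := by
  set D := ∑ s, ch.pS s * κ s + l * B with hDdef
  have key : ∀ δ : ℝ, 0 < δ → δ ≤ 1 → (1 - δ) * (R * Real.log 2) ≤ D := by
    intro δ hδ hδ1
    obtain ⟨N, hN⟩ := h δ hδ
    have hbound : ∀ n : ℕ, N ≤ n → n * ((1 - δ) * (R * Real.log 2) - D) ≤ 1 := by
      intro n hn
      obtain ⟨M, c, hMR, hcost, herr⟩ := hN n hn
      have h2 : (0 : ℝ) < 2 ^ ((n : ℝ) * R) := by positivity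
      have hM : 0 < M := by exact_mod_cast h2.trans_le hMR
      have hM1 : (1 : ℝ) ≤ M := by exact_mod_cast hM
      have h3 := ch.one_sub_errorProb_mul_log_le hq0 hq hac hd hM c
      have h4 : (n : ℝ) * R * Real.log 2 ≤ Real.log M := by
        rw [← Real.log_rpow two_pos]
        exact Real.log_le_log h2 hMR
      have h5 := mul_le_mul_of_nonneg_right (sub_le_sub_left herr 1) (Real.log_nonneg hM1)
      have h6 := mul_le_mul_of_nonneg_left h4 (sub_nonneg.2 hδ1)
      have h7 := mul_le_mul_of_nonneg_left hcost hl
      rw [hDdef]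
      nlinarith
    by_contra! hlt
    obtain ⟨n, hn⟩ := exists_nat_gt (1 / ((1 - δ) * (R * Real.log 2) - D))
    rw [div_lt_iff₀ (sub_pos.2 hlt)] at hn
    have h1 := hbound (max N n) (le_max_left _ _)
    have h2 : (n : ℝ) ≤ (max N n : ℕ) := by exact_mod_cast le_max_right _ _
    nlinarith [mul_le_mul_of_nonneg_right h2 (sub_pos.2 hlt).le]
  have ht : Filter.Tendsto (fun δ : ℝ ↦ (1 - δ) * (R * Real.log 2)) (nhdsWithin 0 (Set.Ioi 0))
      (nhds (R * Real.log 2)) := by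
    have : Continuous fun δ : ℝ ↦ (1 - δ) * (R * Real.log 2) := by fun_prop
    simpa using (this.tendsto 0).mono_left nhdsWithin_le_nhds
  refine le_of_tendsto ht ?_
  filter_upwards [Ioc_mem_nhdsGT (zero_lt_one' ℝ)] with δ hδ
  exact key δ hδ.1 hδ.2

theorem Achievable.mono {ch : StateChannel X S Y} {B B' R : ℝ} (hB : B ≤ B')
    (h : ch.Achievable B R) : ch.Achievable B' R := by
  intro δ hδ
  obtain ⟨N, hN⟩ := h δ hδ
  refine ⟨N, fun n hn ↦ ?_⟩
  obtain ⟨M, c, h1, h2, h3⟩ := hN n hn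
  exact ⟨M, c, h1, h2.trans (mul_le_mul_of_nonneg_left hB n.cast_nonneg), h3⟩

end StateChannel

open Real in
/-- Mutual information in nats as a combination of entropies. -/
theorem mutualInfoBits_mul_log_eq_negMulLog {A B : Type} [Fintype A] [Fintype B] {P : A → B → ℝ}
    (hP0 : ∀ a b, 0 ≤ P a b) :
    mutualInfoBits P * log 2 = ∑ a, negMulLog (∑ b, P a b) + ∑ b, negMulLog (∑ a, P a b)
      - ∑ a, ∑ b, negMulLog (P a b) := by
  have h : ∀ a b, P a b * log (P a b / ((∑ b', P a b') * ∑ a', P a' b))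
      = P a b * -log (∑ b', P a b') + P a b * -log (∑ a', P a' b) - negMulLog (P a b) := by
    intro a b
    rcases (hP0 a b).eq_or_lt with h0 | h0
    · simp [← h0]
    · have h1 : 0 < ∑ b', P a b' :=
        h0.trans_le (Finset.single_le_sum (f := P a) (fun b _ ↦ hP0 a b) (Finset.mem_univ b))
      have h2 : 0 < ∑ a', P a' b :=
        h0.trans_le (Finset.single_le_sum (f := fun a ↦ P a b) (fun a _ ↦ hP0 a b)
          (Finset.mem_univ a))
      rw [log_div h0.ne' (mul_pos h1 h2).ne', log_mul h1.ne' h2.ne', negMulLog]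
      ring
  rw [mutualInfoBits_mul_log]
  simp only [h, Finset.sum_add_distrib, Finset.sum_sub_distrib, ← Finset.sum_mul]
  rw [Finset.sum_comm (f := fun a b ↦ P a b * -log (∑ a', P a' b))]
  simp only [← Finset.sum_mul, negMulLog]
  congr 2 <;> exact Finset.sum_congr rfl fun _ _ ↦ by ring

section WriteOnceMemory

variable {α β ε : ℝ}

theorem binConv_nonneg (hα : α ∈ Set.Icc (0 : ℝ) 1) (hε : ε ∈ Set.Icc (0 : ℝ) 1) :
    0 ≤ binConv ε α :=
  add_nonneg (mul_nonneg hε.1 (sub_nonneg.2 hα.2)) (mul_nonneg (sub_nonneg.2 hε.2) hα.1)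

theorem binConv_mem_Ioo (hα : α ∈ Set.Icc (0 : ℝ) 1) (hε0 : 0 < ε) (hε1 : ε < 1) :
    binConv ε α ∈ Set.Ioo (0 : ℝ) 1 := by
  obtain ⟨h0, h1⟩ := hα
  have h : 1 - binConv ε α = ε * α + (1 - ε) * (1 - α) := by rw [binConv]; ring
  constructor
  · rw [binConv]
    rcases h0.eq_or_lt with h | h
    · rw [← h]; linarith
    · have := mul_pos (sub_pos.2 hε1) h
      have := mul_nonneg hε0.le (sub_nonneg.2 h1)
      linarith
  · rw [← sub_pos, h]
    rcases h0.eq_or_lt with h | h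
    · rw [← h]; linarith
    · have := mul_pos hε0 h
      have := mul_nonneg (sub_pos.2 hε1).le (sub_nonneg.2 h1)
      linarith

theorem div_binConv_mem (hα : α ∈ Set.Icc (0 : ℝ) 1) (hε : ε ∈ Set.Icc (0 : ℝ) 1) :
    ε * (1 - α) / binConv ε α ∈ Set.Icc (0 : ℝ) 1 := by
  have h1 : 0 ≤ ε * (1 - α) := mul_nonneg hε.1 (sub_nonneg.2 hα.2)
  refine ⟨div_nonneg h1 (binConv_nonneg hα hε), div_le_one_of_le₀ ?_ (binConv_nonneg hα hε)⟩
  have := mul_nonneg (sub_nonneg.2 hε.2) hα.1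
  rw [binConv]
  linarith

theorem div_binConv_mul (hα : α ∈ Set.Icc (0 : ℝ) 1) (hε : ε ∈ Set.Icc (0 : ℝ) 1) :
    ε * (1 - α) / binConv ε α * binConv ε α = ε * (1 - α) := by
  by_cases h : binConv ε α = 0
  · have h1 : 0 ≤ ε * (1 - α) := mul_nonneg hε.1 (sub_nonneg.2 hα.2)
    have h2 := mul_nonneg (sub_nonneg.2 hε.2) hα.1
    rw [h, mul_zero]
    rw [binConv] at h
    linarith
  · exact div_mul_cancel₀ _ h

/-- The conditional pmf `p(v | s)` and the function `x(v, s) = v ∧ ¬ s` for the binary write-once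
memory with writing noise. -/
noncomputable def womChoice (hα : α ∈ Set.Icc (0 : ℝ) 1) (hε : ε ∈ Set.Icc (0 : ℝ) 1) :
    AuxChoice Bool Bool Bool where
  p s := bernoulliPmf (if s then ε * (1 - α) / binConv ε α else ε)
  p_nonneg s := bernoulliPmf_nonneg (by cases s; exacts [hε, div_binConv_mem hα hε])
  p_sum s := bernoulliPmf_sum _
  x v s := v && !s

theorem auxCost_womChoice (hα : α ∈ Set.Icc (0 : ℝ) 1) (hβ : β ∈ Set.Icc (0 : ℝ) 1)
    (hε : ε ∈ Set.Icc (0 : ℝ) 1) :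
    (noisyWOM α β hα hβ).auxCost (womChoice hα hε) = (1 - β) * ε := by
  simp [StateChannel.auxCost, noisyWOM, womChoice, bernoulliPmf]

/-- The rate, in bits, of the write-once memory when a fraction `ε` of the free cells is written. -/
noncomputable def womRate (α β ε : ℝ) : ℝ :=
  (1 - β) * (binEntropyBits (binConv ε α) - binEntropyBits α)

theorem womRate_mul_log (α β ε : ℝ) : womRate α β ε * Real.log 2
    = (1 - β) * (Real.binEntropy (binConv ε α) - Real.binEntropy α) := by
  have : Real.log 2 ≠ 0 := (Real.log_pos one_lt_two).ne'
  rw [womRate, binEntropyBits, binEntropyBits]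
  field_simp

theorem continuous_womRate (α β : ℝ) : Continuous (womRate α β) := by
  unfold womRate binEntropyBits binConv
  have := Real.binEntropy_continuous
  fun_prop

theorem womRate_zero (α β : ℝ) : womRate α β 0 = 0 := by simp [womRate, binConv]

open Real in
theorem gpRate_womChoice (hα : α ∈ Set.Icc (0 : ℝ) 1) (hβ : β ∈ Set.Icc (0 : ℝ) 1)
    (hε : ε ∈ Set.Icc (0 : ℝ) 1) :
    (noisyWOM α β hα hβ).gpRate (womChoice hα hε) = womRate α β ε := by
  refine mul_right_cancel₀ (log_pos one_lt_two).ne' ?_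
  rw [womRate_mul_log, StateChannel.gpRate, sub_mul,
    mutualInfoBits_mul_log_eq_negMulLog (StateChannel.jointVY_nonneg _ _),
    mutualInfoBits_mul_log_eq_negMulLog (StateChannel.jointVS_nonneg _ _)]
  simp only [StateChannel.sum_jointVY_right, StateChannel.sum_jointVS_left]
  have hq := div_binConv_mul hα hε
  have hJ : ∀ s v, (noisyWOM α β hα hβ).jointVS (womChoice hα hε) v s = bernoulliPmf β s *
    bernoulliPmf (if s then ε * (1 - α) / binConv ε α else ε) v := fun s v ↦ rfl
  have hY : ∀ v y, (noisyWOM α β hα hβ).jointVY (womChoice hα hε) v y = ∑ s, bernoulliPmf β s *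
    bernoulliPmf (if s then ε * (1 - α) / binConv ε α else ε) v *
      bernoulliPmf (womOne α (v && !s) s) y := fun v y ↦ rfl
  have hS : ∀ s, (noisyWOM α β hα hβ).pS s = bernoulliPmf β s := fun s ↦ rfl
  simp only [hJ, hY, hS]
  set q := ε * (1 - α) / binConv ε α
  set c := binConv ε α with hc
  have hc' : (1 - q) * c = (1 - ε) * α := by rw [sub_mul, hq, hc, binConv]; ring
  simp only [Fintype.sum_bool, bernoulliPmf, womOne, Bool.and_true, Bool.and_false, Bool.not_true,
    Bool.not_false, if_true, Bool.false_eq_true, if_false, mul_zero, mul_one, zero_add, sub_self,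
    sub_sub_cancel, binEntropy_eq_negMulLog_add_negMulLog_one_sub]
  have e11 : β * q + (1 - β) * ε * (1 - α) = q * (β + (1 - β) * c) := by
    linear_combination (-(1 - β)) * hq
  have e01 : β * (1 - q) + (1 - β) * (1 - ε) * α = (1 - q) * (β + (1 - β) * c) := by
    linear_combination (-(1 - β)) * hc'
  have e1 : q * (β + (1 - β) * c) + (1 - q) * (β + (1 - β) * c) = β + (1 - β) * c := by ring
  have e0 : (1 - β) * ε * α + (1 - β) * (1 - ε) * (1 - α) = (1 - β) * (1 - c) := by
    rw [hc, binConv]; ring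
  have hA1 := congrArg negMulLog hq
  have hA0 := congrArg negMulLog hc'
  rw [e11, e01, e1, e0]
  simp only [negMulLog_mul] at hA1 hA0 ⊢
  have hcc : c = ε * (1 - α) + (1 - ε) * α := rfl
  linear_combination (-(1 - β)) * (hA1 + hA0) - negMulLog (1 - β) * hcc

end WriteOnceMemory

section WriteOnceMemory

variable {α β ε : ℝ}

open Real in
/-- The converse bound for the write-once memory from the output pmf `ε * α` of the free cells. -/
theorem noisyWOM_mul_log_le (hα : α ∈ Set.Icc (0 : ℝ) 1) (hβ : β ∈ Set.Icc (0 : ℝ) 1)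
    (hε0 : 0 < ε) (hε2 : ε ≤ 1 / 2) :
    ∃ l : ℝ, 0 ≤ l ∧ ∀ B R : ℝ, (noisyWOM α β hα hβ).Achievable B R →
      R * log 2 ≤ womRate α β ε * log 2 + l * (B - (1 - β) * ε) := by
  obtain ⟨hc0, hc1⟩ := binConv_mem_Ioo hα hε0 (by linarith)
  set c := binConv ε α with hc
  have hc1' : 0 < 1 - c := sub_pos.2 hc1
  have hterm : ∀ p r : ℝ, 0 < r → p * log (p / r) = -negMulLog p - p * log r := by
    intro p r hr
    by_cases hp : p = 0
    · simp [hp]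
    · rw [log_div hp hr.ne', negMulLog]; ring
  have hl : 0 ≤ (1 - 2 * α) * (log (1 - c) - log c) := by
    have h : 1 - 2 * c = (1 - 2 * ε) * (1 - 2 * α) := by rw [hc, binConv]; ring
    rcases le_total (2 * α) 1 with hα2 | hα2
    · refine mul_nonneg (by linarith) (sub_nonneg.2 (log_le_log hc0 ?_))
      have := mul_nonneg (by linarith : 0 ≤ 1 - 2 * ε) (by linarith : 0 ≤ 1 - 2 * α)
      linarith
    · refine mul_nonneg_of_nonpos_of_nonpos (by linarith) (sub_nonpos.2 (log_le_log hc1' ?_))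
      have := mul_nonneg (by linarith : 0 ≤ 1 - 2 * ε) (by linarith : 0 ≤ 2 * α - 1)
      linarith
  refine ⟨_, hl, fun B R h ↦ ?_⟩
  have key := h.mul_log_le (q := fun s ↦ bernoulliPmf (if s then 1 else c))
    (κ := fun s ↦ if s then 0 else
      -negMulLog α - negMulLog (1 - α) - α * log c - (1 - α) * log (1 - c))
    (fun s y ↦ bernoulliPmf_nonneg (by cases s; exacts [⟨hc0.le, hc1.le⟩, by simp]) y)
    (fun s ↦ bernoulliPmf_sum _) (by
      intro x s y
      cases s <;> cases y <;>
        simp [noisyWOM, bernoulliPmf, womOne, hc0.ne', hc1'.ne']) hl (by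
      intro x s
      cases s
      · cases x <;>
        · simp only [noisyWOM, womOne, bernoulliPmf, Fintype.sum_bool, if_true,
            Bool.false_eq_true, if_false, hterm _ _ hc0, hterm _ _ hc1', sub_sub_cancel]
          linarith
      · cases x
        · simp [noisyWOM, womOne, bernoulliPmf]
        · simpa [noisyWOM, womOne, bernoulliPmf] using hl)
  refine key.trans (le_of_eq ?_)
  rw [womRate_mul_log, ← hc]
  have hcc : c = ε * (1 - α) + (1 - ε) * α := rfl
  simp only [noisyWOM, bernoulliPmf, Fintype.sum_bool, if_true, Bool.false_eq_true, if_false,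
    binEntropy_eq_negMulLog_add_negMulLog_one_sub]
  have hn : ∀ p, negMulLog p = -p * log p := fun _ ↦ rfl
  rw [hn c, hn (1 - c)]
  linear_combination (1 - β) * (log c - log (1 - c)) * hcc

/-- A rate that is achievable for all costs above `(1 - β) ε` is at most the capacity. -/
theorem noisyWOM_rate_le (hα : α ∈ Set.Icc (0 : ℝ) 1) (hβ : β ∈ Set.Icc (0 : ℝ) 1) (hβ1 : β < 1)
    (hε0 : 0 ≤ ε) (hε2 : ε ≤ 1 / 2) {R : ℝ}
    (hR : ∀ B, (1 - β) * ε < B → (noisyWOM α β hα hβ).Achievable B R) :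
    R ≤ womRate α β ε := by
  have hlog : 0 < Real.log 2 := Real.log_pos one_lt_two
  have hβ' : 0 < 1 - β := sub_pos.2 hβ1
  rcases hε0.eq_or_lt with rfl | hε0
  · have ht : Filter.Tendsto (womRate α β) (nhdsWithin 0 (Set.Ioi 0)) (nhds (womRate α β 0)) :=
      ((continuous_womRate α β).tendsto 0).mono_left nhdsWithin_le_nhds
    refine ge_of_tendsto ht ?_
    filter_upwards [Ioc_mem_nhdsGT (by norm_num : (0 : ℝ) < 1 / 2)] with e he
    obtain ⟨l, -, hl⟩ := noisyWOM_mul_log_le hα hβ he.1 he.2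
    have := hl _ R (hR ((1 - β) * e) (by rw [mul_zero]; exact mul_pos hβ' he.1))
    rw [sub_self, mul_zero, add_zero] at this
    exact le_of_mul_le_mul_right this hlog
  · obtain ⟨l, hl0, hl⟩ := noisyWOM_mul_log_le hα hβ hε0 hε2
    refine le_of_mul_le_mul_right (le_of_forall_pos_le_add fun e he ↦ ?_) hlog
    have h1 : 0 < e / (l + 1) := by positivity
    have h2 := hl _ R (hR ((1 - β) * ε + e / (l + 1)) (by linarith))
    have h3 : l * (e / (l + 1)) ≤ e := by
      rw [mul_div_assoc', div_le_iff₀ (by positivity)]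
      nlinarith
    rw [add_sub_cancel_left] at h2
    linarith

theorem noisyWOM_achievable (hα : α ∈ Set.Icc (0 : ℝ) 1) (hβ : β ∈ Set.Icc (0 : ℝ) 1)
    (hβ1 : β < 1) (hε0 : 0 ≤ ε) (hε2 : ε ≤ 1 / 2) {R : ℝ} (hR : R < womRate α β ε) :
    (noisyWOM α β hα hβ).Achievable ((1 - β) * ε) R := by
  have hβ' : 0 < 1 - β := sub_pos.2 hβ1
  have hx₀ : (noisyWOM α β hα hβ).cost false ≤ (1 - β) * ε := by
    simpa [noisyWOM] using mul_nonneg hβ'.le hε0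
  rcases le_total R 0 with hR0 | hR0
  · exact StateChannel.achievable_of_nonpos _ hx₀ hR0
  rcases hε0.eq_or_lt with rfl | hε0
  · rw [womRate_zero] at hR
    exact absurd hR hR0.not_gt
  have ht : Filter.Tendsto (womRate α β) (nhdsWithin ε (Set.Iio ε)) (nhds (womRate α β ε)) :=
    ((continuous_womRate α β).tendsto ε).mono_left nhdsWithin_le_nhds
  obtain ⟨e, heR, he⟩ := ((ht.eventually_const_lt hR).and (Ico_mem_nhdsLT hε0)).exists
  have he' : e ∈ Set.Icc (0 : ℝ) 1 := ⟨he.1, by linarith [he.2]⟩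
  refine StateChannel.achievable_of_lt_gpRate _ (womChoice hα he') hx₀ ?_ hR0 ?_
  · rw [auxCost_womChoice]
    exact mul_lt_mul_of_pos_left he.2 hβ'
  · rwa [gpRate_womChoice]

end WriteOnceMemory

/-- Capacity of the binary write-once memory with writing noise under the input cost constraint
`B`, and the maximizing choice of `p(v | s)` and `x(v, s)`. -/
theorem theorem4 (α β B ε : ℝ) (hα : α ∈ Set.Icc (0 : ℝ) 1) (hβ : β ∈ Set.Icc (0 : ℝ) 1)
    (hβ1 : β < 1) (hB : 0 ≤ B) (hε : ε = B / (1 - β)) (hε2 : ε ≤ 1 / 2) :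
    (noisyWOM α β hα hβ).IsCapacity B
        ((1 - β) * (binEntropyBits (binConv ε α) - binEntropyBits α)) ∧
      ∃ a : AuxChoice Bool Bool Bool,
        a.p false true = ε ∧
        a.p true true = ε * (1 - α) / binConv ε α ∧
        (∀ v s, a.x v s = (v && !s)) ∧
        (noisyWOM α β hα hβ).IsGPMaximizer B a ∧
        (noisyWOM α β hα hβ).gpRate a =
          (1 - β) * (binEntropyBits (binConv ε α) - binEntropyBits α) := by
  have hβ' : 0 < 1 - β := sub_pos.2 hβ1
  have hε0 : 0 ≤ ε := by rw [hε]; exact div_nonneg hB hβ'.le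
  have hε1 : ε ∈ Set.Icc (0 : ℝ) 1 := ⟨hε0, by linarith⟩
  obtain rfl : B = (1 - β) * ε := by rw [hε, mul_div_cancel₀ _ hβ'.ne']
  refine ⟨⟨fun R hR ↦ noisyWOM_rate_le hα hβ hβ1 hε0 hε2 fun B' hB' ↦
    StateChannel.Achievable.mono hB'.le hR, fun b hb ↦ le_of_forall_lt fun R hR ↦ ?_⟩,
    womChoice hα hε1, rfl, rfl, fun v s ↦ rfl, ⟨(auxCost_womChoice hα hβ hε1).le, ?_⟩,
    gpRate_womChoice hα hβ hε1⟩
  · obtain ⟨R', hRR', hR'⟩ := exists_between hR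
    exact hRR'.trans_le (hb (noisyWOM_achievable hα hβ hβ1 hε0 hε2 hR'))
  · intro V' _ a' ha'
    rw [gpRate_womChoice]
    refine le_of_forall_lt_imp_le_of_dense fun R hR ↦
      noisyWOM_rate_le hα hβ hβ1 hε0 hε2 fun B' hB' ↦ ?_
    have hx₀ : (noisyWOM α β hα hβ).cost false ≤ B' := by
      simpa [noisyWOM] using hB.trans hB'.le
    rcases le_total R 0 with hR0 | hR0
    · exact StateChannel.achievable_of_nonpos _ hx₀ hR0
    · exact StateChannel.achievable_of_lt_gpRate _ a' hx₀ (ha'.trans_lt hB') hR0 hR
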